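/- **Setting.** Let $(\mathcal E,\mathcal F)$ be a resistance form on a nonempty set $X$ and let $R$ be its resistance metric. Assume that $(X,R)$ is separable and locally compact, that its closed balls are compact, and that $(\mathcal E,\mathcal F)$ is regular, i.e. $\mathcal F\cap C_c(X)$ is uniformly dense in $C_c(X)$. Let $\mu$ be a Borel measure on $(X,R)$ with $0<\mu(B(x,r))<\infty$ for all $x\in X$, $r>0$. Let $\mathcal D(\mathcal E)$ be the domain of the closure of $(\mathcal E,\mathcal F\cap C_c(X))$ on $L^2(X,\mu)$. Let $(V_m)_m$ be an increasing sequence of finite subsets of $X$ with dense union. The restriction of $\mathcal E$ to $V_m$ has the form $\frac12\sum_{p,q\in V_m}c(m;p,q)(u(p)-u(q))^2$ with symmetric $c(m;p,q)\ge 0$. For $g\in C_c(X)$, $f\in\mathcal F\cap C_c(X)$ and $v:X\times X\to\mathbb R$ put $(g\cdot v)(x,y)=\frac12(g(x)+g(y))v(x,y)$ and $d_uf(x,y)=f(x)-f(y)$. Let $\mathcal H$ be the Hilbert space obtained from the finite linear combinations of functions $g\cdot d_uf$ by factoring and completing with respect to $$\langle \omega,\eta\rangle_{\mathcal H}=\lim_{m\to\infty}\frac12\sum_{p,q\in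 V_m}c(m;p,q)\,\omega(p,q)\,\eta(p,q).$$ Let $\partial f\in\mathcal H$ be the class of $d_uf$, and for $g\in\mathcal F\cap C_c(X)$ let $v\mapsto g\cdot v$ also denote the bounded extension of the action to $\mathcal H$. **Coefficients.** Let $a:\mathcal H\to\mathcal H$ be bounded, linear and symmetric with $\lambda\|v\|_{\mathcal H}^2\le\langle av,v\rangle_{\mathcal H}\le\Lambda\|v\|_{\mathcal H}^2$ for all $v\in\mathcal H$, where $0<\lambda<\Lambda$. Let $b,\hat b\in\mathcal H$ be in the Hardy class: there are constants $\delta(b),\delta(\hat b)\in(0,\infty)$, $\gamma(b),\gamma(\hat b)\in[0,\infty)$ such that $$\|g\cdot b\|_{\mathcal H}^2\le\delta(b)\,\mathcal E(g)+\gamma(b)\,\|g\|_{L^2(X,\mu)}^2,\qquad g\in\mathcal F\cap C_c(X),$$ and likewise for $\hat b$. Let $c\in L^\infty(X,\mu)$. Assume $$\lambda_0:=\tfrac12\Big(\lambda-\sqrt{\delta(b)}-\sqrt{\delta(\hat b)}\Big)>0,\qquad c_0:=\operatorname*{ess\,inf}_{x\in X}(-c(x))-\frac{\gamma(b)+\gamma(\hat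 b)}{2\lambda_0}>0 .$$ On $\mathcal F\cap C_c(X)$ let $$\mathcal Q(f,g)=\langle a\,\partial f,\partial g\rangle_{\mathcal H}-\langle g\cdot b,\partial f\rangle_{\mathcal H}-\langle f\cdot\hat b,\partial g\rangle_{\mathcal H}-\langle cf,g\rangle_{L^2(X,\mu)} .$$ **Statement.** The form $\mathcal Q$ extends to $\mathcal D(\mathcal E)$ by continuity: $\mathcal Q(u,v)=\lim_n\mathcal Q(f_n,g_n)$ whenever $f_n,g_n\in\mathcal F\cap C_c(X)$ are $\mathcal E$-Cauchy and converge in $L^2(X,\mu)$ to $u$ and $v$. Let $\mathcal L^{\mathcal Q}$ be its generator: $u\in\mathcal D(\mathcal L^{\mathcal Q})$ and $\mathcal L^{\mathcal Q}u=h\in L^2(X,\mu)$ iff $u\in\mathcal D(\mathcal E)$ and $\mathcal Q(u,v)=-\langle h,v\rangle_{L^2(X,\mu)}$ for all $v\in\mathcal D(\mathcal E)$. Then $\mathcal L^{\mathcal Q}$ generates a unique strongly continuous contraction semigroup $(T_t^{\mathcal Q})_{t\ge 0}$ on $L^2(X,\mu)$. Moreover there is $K>0$ for which the sector condition $$|\langle(-\mathcal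 L^{\mathcal Q}-\varepsilon)f,g\rangle|\le K\,\langle(-\mathcal L^{\mathcal Q}-\varepsilon)f,f\rangle^{1/2}\langle(-\mathcal L^{\mathcal Q}-\varepsilon)g,g\rangle^{1/2},\quad f,g\in\mathcal D(\mathcal L^{\mathcal Q}),\ 0\le\varepsilon\le c_0/2,\qquad (1)$$ holds, with inner products in $L^2(X,\mu)$. For any $\mathring u\in L^2(X,\mu)$ the function $u(t)=T_t^{\mathcal Q}\mathring u$ is the unique $u\in C^1((0,\infty),L^2(X,\mu))\cap C([0,\infty),L^2(X,\mu))$ with $u(t)\in\mathcal D(\mathcal L^{\mathcal Q})$ for $t>0$ and $$\partial_tu(t)=\mathcal L^{\mathcal Q}u(t),\quad t>0,\qquad u(0)=\mathring u .$$ For every $K>0$ there is a constant $C_K>0$, depending on nothing but $K$, such that whenever (1) holds with $K$, $$\mathcal Q(u(t))+\|u(t)\|_{L^2(X,\mu)}^2\le\Big(\frac{C_K}{t}+1\Big)\|\mathring u\|_{L^2(X,\mu)}^2,\qquad t>0 .$$ -/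

import Mathlib

open Filter Topology MeasureTheory
open scoped CompactlySupported

universe u

noncomputable section

/-- A resistance form on a set `X`: a domain `F` of real functions and a bilinear form `E` on it. -/
structure ResistanceForm (X : Type u) where
  F : Submodule ℝ (X → ℝ)
  E : LinearMap.BilinForm ℝ F
  symm : ∀ u v : F, E u v = E v u
  nonneg : ∀ u : F, 0 ≤ E u u
  const_mem : ∀ r : ℝ, (fun _ => r) ∈ F
  eq_zero_iff : ∀ u : F, E u u = 0 ↔ ∃ r : ℝ, ∀ x, u.1 x = r
  /-- Completeness of `F` modulo constants with respect to `E`. -/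
  complete : ∀ u : ℕ → F,
    (∀ ε > 0, ∃ N, ∀ m ≥ N, ∀ n ≥ N, E (u m - u n) (u m - u n) < ε) →
      ∃ v : F, Tendsto (fun n => E (u n - v) (u n - v)) atTop (𝓝 0)
  extension : ∀ (V : Finset X) (v : X → ℝ), ∃ u : F, ∀ x ∈ V, u.1 x = v x
  bddAbove : ∀ x y : X,
    BddAbove {r : ℝ | ∃ u : F, 0 < E u u ∧ r = (u.1 x - u.1 y) ^ 2 / E u u}
  markov : ∀ u : F, ∃ h : (fun x => max 0 (min 1 (u.1 x))) ∈ F, E ⟨_, h⟩ ⟨_, h⟩ ≤ E u u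

namespace ResistanceForm

variable {X : Type u} (S : ResistanceForm X)

/-- The resistance metric `R(x, y)`. -/
def resistance (x y : X) : ℝ :=
  sSup {r : ℝ | ∃ u : S.F, 0 < S.E u u ∧ r = (u.1 x - u.1 y) ^ 2 / S.E u u}

/-- The quadratic form `v ↦ E_V(v)` of the restriction of the resistance form to a finite set `V`
(only the values of `v` on `V` matter). -/
def traceEnergy (V : Finset X) (v : X → ℝ) : ℝ :=
  sInf {r : ℝ | ∃ u : S.F, (∀ x ∈ V, u.1 x = v x) ∧ r = S.E u u}

/-- The conductance between two distinct points `p` and `q` of the finite set `V`, that is,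
`- E_V(1_p, 1_q)`, written through polarization. See `traceEnergy_eq` and
`conductance_nonneg`. -/
def conductance (V : Finset X) (p q : X) : ℝ :=
  open Classical in
  if p = q then 0 else
    (S.traceEnergy V (Set.indicator {p} 1) + S.traceEnergy V (Set.indicator {q} 1)
      - S.traceEnergy V (Set.indicator {p} 1 + Set.indicator {q} 1)) / 2

theorem cauchy_schwarz (u v : S.F) : (S.E u v) ^ 2 ≤ S.E u u * S.E v v :=
  S.E.apply_sq_le_of_symm S.nonneg ⟨fun x y => S.symm x y⟩ u v

theorem energy_const (r : ℝ) : S.E ⟨_, S.const_mem r⟩ ⟨_, S.const_mem r⟩ = 0 :=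
  (S.eq_zero_iff _).2 ⟨r, fun _ => rfl⟩

theorem energy_const_right (u : S.F) (r : ℝ) : S.E u ⟨_, S.const_mem r⟩ = 0 := by
  have h := S.cauchy_schwarz u ⟨_, S.const_mem r⟩
  rw [S.energy_const, mul_zero] at h
  exact pow_eq_zero_iff (two_ne_zero) |>.1 (le_antisymm h (sq_nonneg _))

theorem sq_sub_le (u : S.F) (x y : X) :
    (u.1 x - u.1 y) ^ 2 ≤ S.resistance x y * S.E u u := by
  rcases (S.nonneg u).eq_or_lt with h | h
  · obtain ⟨r, hr⟩ := (S.eq_zero_iff u).1 h.symm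
    simp [hr, ← h]
  · rw [← div_le_iff₀ h]
    exact le_csSup (S.bddAbove x y) ⟨u, h, rfl⟩

theorem energy_add (u v : S.F) : S.E (u + v) (u + v) = S.E u u + 2 * S.E u v + S.E v v := by
  simp only [map_add, LinearMap.add_apply]
  rw [S.symm v u]; ring

theorem energy_sub (u v : S.F) : S.E (u - v) (u - v) = S.E u u - 2 * S.E u v + S.E v v := by
  simp only [map_sub, LinearMap.sub_apply]
  rw [S.symm v u]; ring

theorem energy_add_smul (u v : S.F) (t : ℝ) :
    S.E (u + t • v) (u + t • v) = S.E u u + 2 * t * S.E u v + t ^ 2 * S.E v v := by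
  rw [energy_add]
  simp only [map_smul, LinearMap.smul_apply, smul_eq_mul]; ring

/-- If `E(u_n - v) → 0` then differences of values converge. -/
theorem tendsto_diff {w : ℕ → S.F} {v : S.F}
    (h : Tendsto (fun n => S.E (w n - v) (w n - v)) atTop (𝓝 0)) (x y : X) :
    Tendsto (fun n => ((w n).1 x - v.1 x) - ((w n).1 y - v.1 y)) atTop (𝓝 0) := by
  have h1 : Tendsto (fun n => (((w n).1 x - v.1 x) - ((w n).1 y - v.1 y)) ^ 2) atTop (𝓝 0) := by
    refine squeeze_zero (fun n => sq_nonneg _) (fun n => S.sq_sub_le (w n - v) x y) ?_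
    simpa using h.const_mul (S.resistance x y)
  have h2 := h1.sqrt
  simp only [Real.sqrt_sq_eq_abs, Real.sqrt_zero] at h2
  exact (tendsto_zero_iff_abs_tendsto_zero _).2 h2

theorem tendsto_energy_left {w : ℕ → S.F} {v : S.F}
    (h : Tendsto (fun n => S.E (w n - v) (w n - v)) atTop (𝓝 0)) (z : S.F) :
    Tendsto (fun n => S.E (w n) z) atTop (𝓝 (S.E v z)) := by
  have h1 : Tendsto (fun n => (S.E (w n - v) z) ^ 2) atTop (𝓝 0) := by
    refine squeeze_zero (fun n => sq_nonneg _) (fun n => S.cauchy_schwarz (w n - v) z) ?_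
    simpa using h.mul_const (S.E z z)
  have h2 := h1.sqrt
  simp only [Real.sqrt_sq_eq_abs, Real.sqrt_zero] at h2
  have h3 := (tendsto_zero_iff_abs_tendsto_zero _).2 h2
  have h4 := h3.add_const (S.E v z)
  simpa using h4

/-- `w` is the harmonic extension of `v` from `V`. -/
def IsHarmonicExt (V : Finset X) (v : X → ℝ) (w : S.F) : Prop :=
  (∀ x ∈ V, w.1 x = v x) ∧ ∀ z : S.F, (∀ x ∈ V, z.1 x = 0) → S.E w z = 0

theorem traceEnergy_of_harmonic {V : Finset X} {v : X → ℝ} {w : S.F}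
    (h : S.IsHarmonicExt V v w) : S.traceEnergy V v = S.E w w := by
  apply IsLeast.csInf_eq
  refine ⟨⟨w, h.1, rfl⟩, ?_⟩
  rintro r ⟨z, hz, rfl⟩
  have h0 : S.E w (z - w) = 0 := h.2 _ fun x hx => by simp [hz x hx, h.1 x hx]
  have h1 := S.energy_add w (z - w)
  rw [add_sub_cancel, h0] at h1
  have := S.nonneg (z - w)
  linarith

theorem traceEnergy_le {V : Finset X} {v : X → ℝ} (z : S.F) (hz : ∀ x ∈ V, z.1 x = v x) :
    S.traceEnergy V v ≤ S.E z z :=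
  csInf_le ⟨0, by rintro r ⟨u, -, rfl⟩; exact S.nonneg u⟩ ⟨z, hz, rfl⟩

theorem exists_harmonic (V : Finset X) (v : X → ℝ) : ∃ w : S.F, S.IsHarmonicExt V v w := by
  classical
  rcases V.eq_empty_or_nonempty with rfl | ⟨x0, hx0⟩
  · exact ⟨0, by simp, by simp⟩
  set A : Set ℝ := {r : ℝ | ∃ u : S.F, (∀ x ∈ V, u.1 x = v x) ∧ r = S.E u u} with hA
  set m := sInf A with hm
  have hne : A.Nonempty := by
    obtain ⟨u, hu⟩ := S.extension V v
    exact ⟨_, u, hu, rfl⟩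
  have hlow : ∀ u : S.F, (∀ x ∈ V, u.1 x = v x) → m ≤ S.E u u := fun u hu =>
    S.traceEnergy_le u hu
  have hseq : ∀ n : ℕ, ∃ u : S.F, (∀ x ∈ V, u.1 x = v x) ∧ S.E u u < m + 1 / ((n : ℝ) + 1) := by
    intro n
    have hpos : (0 : ℝ) < 1 / ((n : ℝ) + 1) := Nat.one_div_pos_of_nat
    obtain ⟨r, ⟨u, hu, rfl⟩, hr⟩ := exists_lt_of_csInf_lt hne (lt_add_of_pos_right m hpos)
    exact ⟨u, hu, hr⟩
  choose w hwV hwE using hseq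
  have hdiff : ∀ i j, S.E (w i - w j) (w i - w j) ≤
      2 * (1 / ((i : ℝ) + 1)) + 2 * (1 / ((j : ℝ) + 1)) := by
    intro i j
    have h1 := hlow ((1 / 2 : ℝ) • (w i + w j)) fun x hx => by
      simp [hwV i x hx, hwV j x hx]; ring
    simp only [map_smul, LinearMap.smul_apply, smul_eq_mul] at h1
    have h2 := S.energy_add (w i) (w j)
    have h3 := S.energy_sub (w i) (w j)
    have h4 := hwE i
    have h5 := hwE j
    linarith
  have htend : Tendsto (fun n : ℕ => 1 / ((n : ℝ) + 1)) atTop (𝓝 0) :=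
    tendsto_one_div_add_atTop_nhds_zero_nat
  obtain ⟨v0, hv0⟩ := S.complete w (by
    intro ε hε
    obtain ⟨N, hN⟩ := eventually_atTop.1 (htend.eventually (gt_mem_nhds (by positivity : (0:ℝ) < ε / 4)))
    refine ⟨N, fun i hi j hj => ?_⟩
    have := hdiff i j
    have := hN i hi
    have := hN j hj
    linarith)
  refine ⟨v0 + ⟨_, S.const_mem (v x0 - v0.1 x0)⟩, ?_, ?_⟩
  · intro x hx
    have h := S.tendsto_diff hv0 x x0
    simp only [hwV _ x hx, hwV _ x0 hx0] at h
    have := tendsto_nhds_unique h tendsto_const_nhds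
    simp only [Submodule.coe_add, Pi.add_apply]
    linarith
  · intro z hz
    have hz0 : S.E v0 z = 0 := by
      have key : ∀ t : ℝ, 0 ≤ 2 * t * S.E v0 z + t ^ 2 * S.E z z := by
        intro t
        have h1 : ∀ n : ℕ, -(1 / ((n : ℝ) + 1)) ≤ 2 * t * S.E (w n) z + t ^ 2 * S.E z z := by
          intro n
          have h1 := hlow (w n + t • z) fun x hx => by simp [hwV n x hx, hz x hx]
          rw [S.energy_add_smul] at h1
          have := hwE n
          linarith
        have h2 : Tendsto (fun n => 2 * t * S.E (w n) z + t ^ 2 * S.E z z) atTop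
            (𝓝 (2 * t * S.E v0 z + t ^ 2 * S.E z z)) :=
          ((S.tendsto_energy_left hv0 z).const_mul _).add_const _
        have h3 := le_of_tendsto_of_tendsto' htend.neg h2 h1
        simpa using h3
      by_contra hne0
      have hz' := S.nonneg z
      have := key (-(S.E v0 z) / (S.E z z + 1))
      have hp : 0 < S.E z z + 1 := by linarith
      have e : 2 * (-(S.E v0 z) / (S.E z z + 1)) * S.E v0 z
          + (-(S.E v0 z) / (S.E z z + 1)) ^ 2 * S.E z z
          = -((S.E v0 z) ^ 2 * (S.E z z + 2)) / (S.E z z + 1) ^ 2 := by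
        field_simp; ring
      rw [e, div_nonneg_iff] at this
      have h6 : 0 < (S.E v0 z) ^ 2 * (S.E z z + 2) := by positivity
      rcases this with ⟨h, -⟩ | ⟨-, h⟩
      · linarith
      · have : 0 < (S.E z z + 1) ^ 2 := by positivity
        linarith
    rw [map_add, LinearMap.add_apply, hz0, S.symm _ z, S.energy_const_right, add_zero]

theorem IsHarmonicExt.add {V : Finset X} {v v' : X → ℝ} {w w' : S.F}
    (h : S.IsHarmonicExt V v w) (h' : S.IsHarmonicExt V v' w') :
    S.IsHarmonicExt V (v + v') (w + w') :=
  ⟨fun x hx => by simp [h.1 x hx, h'.1 x hx],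
    fun z hz => by rw [map_add, LinearMap.add_apply, h.2 z hz, h'.2 z hz, add_zero]⟩

theorem conductance_eq {V : Finset X} {p q : X} (hpq : p ≠ q) {hp hq : S.F}
    (h : S.IsHarmonicExt V (Set.indicator {p} 1) hp)
    (h' : S.IsHarmonicExt V (Set.indicator {q} 1) hq) :
    S.conductance V p q = - S.E hp hq := by
  rw [conductance, if_neg hpq, S.traceEnergy_of_harmonic h, S.traceEnergy_of_harmonic h',
    S.traceEnergy_of_harmonic (h.add S h'), S.energy_add]
  ring

theorem conductance_nonneg {V : Finset X} (p q : X) :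
    0 ≤ S.conductance V p q := by
  classical
  by_cases hpq : p = q
  · simp [conductance, hpq]
  obtain ⟨hp, h⟩ := S.exists_harmonic V (Set.indicator {p} 1)
  obtain ⟨hq, h'⟩ := S.exists_harmonic V (Set.indicator {q} 1)
  rw [S.conductance_eq hpq h h']
  have key : ∀ t : ℝ, 0 < t → 2 * S.E hp hq ≤ t * S.E hq hq := by
    intro t ht
    obtain ⟨hmem, hle⟩ := S.markov (hp + (-t) • hq)
    have h1 : S.traceEnergy V (Set.indicator {p} 1) ≤ _ := S.traceEnergy_le ⟨_, hmem⟩ (by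
      intro x hx
      simp only [Submodule.coe_add, Pi.add_apply, Submodule.coe_smul, Pi.smul_apply, smul_eq_mul,
        h.1 x hx, h'.1 x hx]
      by_cases hxp : x = p
      · subst hxp; simp [hpq]
      · by_cases hxq : x = q
        · subst hxq; simp [hxp, ht.le]
        · simp [hxp, hxq])
    rw [S.traceEnergy_of_harmonic h] at h1
    have h2 := h1.trans hle
    rw [S.energy_add_smul] at h2
    have h3 : t * (2 * S.E hp hq) ≤ t * (t * S.E hq hq) := by linarith
    exact le_of_mul_le_mul_left h3 ht
  have h4 : Tendsto (fun t : ℝ => t * S.E hq hq) (𝓝[>] 0) (𝓝 (0 * S.E hq hq)) :=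
    ((continuous_id.mul continuous_const).tendsto 0).mono_left nhdsWithin_le_nhds
  have h5 := ge_of_tendsto h4 (eventually_nhdsWithin_of_forall fun t ht => key t ht)
  linarith

theorem conductance_symm (V : Finset X) (p q : X) :
    S.conductance V p q = S.conductance V q p := by
  classical
  unfold conductance
  by_cases hpq : p = q
  · simp [hpq]
  · rw [if_neg hpq, if_neg (Ne.symm hpq), add_comm (Set.indicator {p} 1 : X → ℝ),
      add_comm (S.traceEnergy V (Set.indicator {p} 1))]

/-- The representation of the trace form through conductances. -/
theorem traceEnergy_eq (V : Finset X) (v : X → ℝ) :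
    S.traceEnergy V v = 1 / 2 * ∑ p ∈ V, ∑ q ∈ V, S.conductance V p q * (v p - v q) ^ 2 := by
  classical
  choose h hh using fun p : X => S.exists_harmonic V (Set.indicator {p} 1)
  have hw : S.IsHarmonicExt V v (∑ p ∈ V, v p • h p) := by
    constructor
    · intro x hx
      have : (∑ p ∈ V, v p • h p : S.F).1 x = ∑ p ∈ V, v p * (h p).1 x := by
        simp [Finset.sum_apply]
      rw [this, Finset.sum_congr rfl fun p _ => by rw [(hh p).1 x hx]]
      simp [Set.indicator_apply, hx]
    · intro z hz
      simp only [map_sum, LinearMap.sum_apply, map_smul, LinearMap.smul_apply]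
      exact Finset.sum_eq_zero fun p _ => by rw [(hh p).2 z hz, smul_zero]
  have hrow : ∀ p ∈ V, ∑ q ∈ V, S.E (h p) (h q) = 0 := by
    intro p _
    have h1 : S.E (h p) ((∑ q ∈ V, h q) - ⟨_, S.const_mem 1⟩) = 0 := by
      apply (hh p).2
      intro x hx
      have : (∑ q ∈ V, h q : S.F).1 x = ∑ q ∈ V, (h q).1 x := by
        simp [Finset.sum_apply]
      simp only [Submodule.coe_sub, Pi.sub_apply]
      rw [this, Finset.sum_congr rfl fun p _ => by rw [(hh p).1 x hx]]
      simp [Set.indicator_apply, hx]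
    rw [map_sub, S.energy_const_right, sub_zero, map_sum] at h1
    exact h1
  have hcol : ∀ q ∈ V, ∑ p ∈ V, S.E (h p) (h q) = 0 := by
    intro q hq
    rw [← hrow q hq]
    exact Finset.sum_congr rfl fun p _ => S.symm _ _
  rw [S.traceEnergy_of_harmonic hw]
  have e1 : ∀ p ∈ V, ∀ q ∈ V, S.conductance V p q * (v p - v q) ^ 2
      = 2 * (v p * (v q * S.E (h p) (h q))) - v p ^ 2 * S.E (h p) (h q)
        - v q ^ 2 * S.E (h p) (h q) := by
    intro p _ q _
    by_cases hpq : p = q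
    · subst hpq; ring
    · rw [S.conductance_eq hpq (hh p) (hh q)]; ring
  rw [Finset.sum_congr rfl fun p hp => Finset.sum_congr rfl (e1 p hp)]
  have z1 : ∑ p ∈ V, ∑ q ∈ V, v p ^ 2 * S.E (h p) (h q) = 0 :=
    Finset.sum_eq_zero fun p hp => by rw [← Finset.mul_sum, hrow p hp, mul_zero]
  have z2 : ∑ p ∈ V, ∑ q ∈ V, v q ^ 2 * S.E (h p) (h q) = 0 := by
    rw [Finset.sum_comm]
    exact Finset.sum_eq_zero fun q hq => by rw [← Finset.mul_sum, hcol q hq, mul_zero]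
  have z3 : S.E (∑ p ∈ V, v p • h p) (∑ q ∈ V, v q • h q)
      = ∑ p ∈ V, ∑ q ∈ V, v p * (v q * S.E (h p) (h q)) := by
    rw [map_sum S.E, LinearMap.sum_apply]
    refine Finset.sum_congr rfl fun p _ => ?_
    rw [map_smul, LinearMap.smul_apply, map_sum, smul_eq_mul, Finset.mul_sum]
    refine Finset.sum_congr rfl fun q _ => ?_
    rw [map_smul, smul_eq_mul]
  simp only [Finset.sum_sub_distrib, z1, z2, sub_zero]
  rw [z3]
  simp only [← Finset.mul_sum]
  ring

end ResistanceForm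

/-- A regular resistance form whose resistance metric is the metric of the space `X`. -/
structure RegularResistanceForm (X : Type u) [MetricSpace X] extends ResistanceForm X where
  dist_eq : ∀ x y : X, dist x y = toResistanceForm.resistance x y
  /-- Regularity: `F ∩ C_c(X)` is uniformly dense in `C_c(X)`. -/
  regular : ∀ (g : C_c(X, ℝ)) (ε : ℝ), 0 < ε →
    ∃ f ∈ F, Continuous f ∧ HasCompactSupport f ∧ ∀ x, |f x - g x| < ε

/-- An increasing sequence of finite subsets of `X` with dense union. -/
structure ExhaustingSequence (X : Type u) [MetricSpace X] where
  set : ℕ → Finset X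
  mono : Monotone set
  dense : Dense (⋃ m, (set m : Set X))

namespace RegularResistanceForm

variable {X : Type u} [MetricSpace X] (S : RegularResistanceForm X) (V : ExhaustingSequence X)

/-- The space `F ∩ C_c(X)`. -/
def core : Submodule ℝ (X → ℝ) where
  carrier := {f | f ∈ S.F ∧ Continuous f ∧ HasCompactSupport f}
  add_mem' := fun hf hg => ⟨S.F.add_mem hf.1 hg.1, hf.2.1.add hg.2.1, hf.2.2.add hg.2.2⟩
  zero_mem' := ⟨S.F.zero_mem, continuous_zero, HasCompactSupport.zero⟩
  smul_mem' := fun r _ hf => ⟨S.F.smul_mem r hf.1, hf.2.1.const_smul r,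
    hf.2.2.smul_left (f := fun _ => r)⟩

/-- An element of `F ∩ C_c(X)`, as an element of `F`. -/
def toF (f : S.core) : S.F := ⟨f.1, f.2.1⟩

/-- An element of `F ∩ C_c(X)`, as an element of `C_c(X)`. -/
def toCc (f : S.core) : C_c(X, ℝ) :=
  ⟨⟨f.1, f.2.2.1⟩, f.2.2.2⟩

/-- `E(f)` for `f` in `F ∩ C_c(X)`. -/
def energy (f : S.core) : ℝ := S.E (S.toF f) (S.toF f)

/-- The action `(g · v)(x, y) = (g(x) + g(y)) / 2 * v(x, y)`. -/
def act (g : X → ℝ) (v : X → X → ℝ) : X → X → ℝ := fun x y => (g x + g y) / 2 * v x y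

/-- The universal derivation `d_u f (x, y) = f(x) - f(y)`. -/
def univDeriv (f : X → ℝ) : X → X → ℝ := fun x y => f x - f y

/-- The space of finite linear combinations of functions `g · d_u f`, where `g ∈ C_c(X)` and
`f ∈ F ∩ C_c(X)`. -/
def omega : Submodule ℝ (X → X → ℝ) :=
  Submodule.span ℝ {ω | ∃ (g : C_c(X, ℝ)) (f : S.core), ω = act g (univDeriv f.1)}

/-- The sum `1/2 ∑_{p, q ∈ V_m} c(m; p, q) φ(p, q)`. -/
def discreteSum (m : ℕ) (φ : X → X → ℝ) : ℝ :=
  1 / 2 * ∑ p ∈ V.set m, ∑ q ∈ V.set m, S.conductance (V.set m) p q * φ p q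

theorem discreteSum_add (m : ℕ) (φ ψ : X → X → ℝ) :
    S.discreteSum V m (φ + ψ) = S.discreteSum V m φ + S.discreteSum V m ψ := by
  simp only [discreteSum, Pi.add_apply, mul_add, Finset.sum_add_distrib]

theorem discreteSum_smul (m : ℕ) (r : ℝ) (φ : X → X → ℝ) :
    S.discreteSum V m (r • φ) = r * S.discreteSum V m φ := by
  simp only [discreteSum, Pi.smul_apply, smul_eq_mul, Finset.mul_sum]
  refine Finset.sum_congr rfl fun p _ => Finset.sum_congr rfl fun q _ => ?_
  ring

theorem discreteSum_mono (m : ℕ) {φ ψ : X → X → ℝ} (h : ∀ x y, φ x y ≤ ψ x y) :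
    S.discreteSum V m φ ≤ S.discreteSum V m ψ := by
  unfold discreteSum
  refine mul_le_mul_of_nonneg_left (Finset.sum_le_sum fun p _ => Finset.sum_le_sum fun q _ => ?_)
    (by norm_num)
  exact mul_le_mul_of_nonneg_left (h p q) (S.conductance_nonneg p q)

theorem discreteSum_sq (m : ℕ) (f : X → ℝ) :
    S.discreteSum V m (univDeriv f * univDeriv f) = S.traceEnergy (V.set m) f := by
  rw [S.traceEnergy_eq]
  simp only [discreteSum, univDeriv, Pi.mul_apply, pow_two]

theorem continuous_of_mem (u : S.F) : Continuous u.1 := by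
  refine continuous_iff_continuousAt.2 fun x => ?_
  have h1 : Tendsto (fun y => (u.1 y - u.1 x) ^ 2) (𝓝 x) (𝓝 0) := by
    refine squeeze_zero (g := fun y => dist y x * S.E u u) (fun y => sq_nonneg _) (fun y => ?_) ?_
    · rw [S.dist_eq]; exact S.sq_sub_le u y x
    · have : Continuous fun y => dist y x * S.E u u := by fun_prop
      simpa using this.tendsto x
  have h2 := h1.sqrt
  simp only [Real.sqrt_sq_eq_abs, Real.sqrt_zero] at h2
  have h3 := ((tendsto_zero_iff_abs_tendsto_zero _).2 h2).add_const (u.1 x)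
  simpa [ContinuousAt] using h3

/-- A continuous function with bounded trace energies is in `F`, and its trace energies
converge to its energy. -/
theorem mem_of_bounded (u : X → ℝ) (hu : Continuous u) (M : ℝ)
    (hM : ∀ m, S.traceEnergy (V.set m) u ≤ M) :
    ∃ h : u ∈ S.F, Tendsto (fun m => S.traceEnergy (V.set m) u) atTop (𝓝 (S.E ⟨u, h⟩ ⟨u, h⟩)) := by
  choose w hw using fun m => S.exists_harmonic (V.set m) u
  have hE : ∀ m, S.traceEnergy (V.set m) u = S.E (w m) (w m) := fun m =>
    S.traceEnergy_of_harmonic (hw m)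
  have hpyth : ∀ m n, m ≤ n →
      S.E (w n - w m) (w n - w m) = S.E (w n) (w n) - S.E (w m) (w m) := by
    intro m n hmn
    have h0 : S.E (w m) (w n - w m) = 0 := (hw m).2 _ fun x hx => by
      simp [(hw m).1 x hx, (hw n).1 x (V.mono hmn hx)]
    have h1 := S.energy_add (w m) (w n - w m)
    rw [add_sub_cancel, h0] at h1
    linarith
  have hmono : Monotone fun m => S.E (w m) (w m) := fun m n hmn => by
    have := hpyth m n hmn
    have := S.nonneg (w n - w m)
    simp only
    linarith
  have hlim : ∃ L, Tendsto (fun m => S.E (w m) (w m)) atTop (𝓝 L) :=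
    ⟨_, tendsto_atTop_ciSup hmono ⟨M, by rintro _ ⟨m, rfl⟩; have := hM m; rw [hE m] at this; exact this⟩⟩
  obtain ⟨L, hL⟩ := hlim
  have hC := hL.cauchySeq
  have hsymm : ∀ m n, S.E (w m - w n) (w m - w n) = S.E (w n - w m) (w n - w m) := fun m n => by
    rw [S.energy_sub, S.energy_sub, S.symm (w m) (w n)]; ring
  obtain ⟨v, hv⟩ := S.complete w (by
    intro ε hε
    obtain ⟨N, hN⟩ := Metric.cauchySeq_iff.1 hC ε hε
    refine ⟨N, fun m hm n hn => ?_⟩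
    have h := hN m hm n hn
    rw [Real.dist_eq] at h
    have h' := abs_lt.1 h
    rcases le_total m n with hmn | hmn
    · rw [hsymm, hpyth m n hmn]; linarith
    · rw [hpyth n m hmn]; linarith)
  have hv_cont := S.continuous_of_mem v
  have hconst : ∃ r : ℝ, ∀ x, u x = v.1 x + r := by
    rcases isEmpty_or_nonempty X with hX | hX
    · exact ⟨0, fun x => (hX.false x).elim⟩
    obtain ⟨x0, hx0⟩ := V.dense.nonempty
    refine ⟨u x0 - v.1 x0, fun x => ?_⟩
    have heq : (fun x => u x) = fun x => v.1 x + (u x0 - v.1 x0) := by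
      refine Continuous.ext_on V.dense hu (by fun_prop) ?_
      intro x hx
      obtain ⟨i, hi⟩ := Set.mem_iUnion.1 hx
      obtain ⟨j, hj⟩ := Set.mem_iUnion.1 hx0
      have h1 := S.tendsto_diff hv x x0
      have h2 : Tendsto (fun n => ((w n).1 x - v.1 x) - ((w n).1 x0 - v.1 x0)) atTop
          (𝓝 ((u x - v.1 x) - (u x0 - v.1 x0))) := by
        refine tendsto_const_nhds.congr' ?_
        filter_upwards [eventually_ge_atTop (max i j)] with n hn
        rw [(hw n).1 x (V.mono (le_of_max_le_left hn) hi),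
          (hw n).1 x0 (V.mono (le_of_max_le_right hn) hj)]
      have := tendsto_nhds_unique h1 h2
      simp only
      linarith
    exact congrFun heq x
  obtain ⟨r, hr⟩ := hconst
  have hu_eq : u = (v + ⟨_, S.const_mem r⟩ : S.F).1 := by
    ext x; simp [hr x]
  have hmem : u ∈ S.F := hu_eq ▸ (v + ⟨_, S.const_mem r⟩ : S.F).2
  refine ⟨hmem, ?_⟩
  have hdiff : ∀ n, S.E (w n - v) (w n - v) = S.E ⟨u, hmem⟩ ⟨u, hmem⟩ - S.E (w n) (w n) := by
    intro n
    have h0 : S.E (w n) (⟨u, hmem⟩ - w n) = 0 := (hw n).2 _ fun x hx => by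
      simp [(hw n).1 x hx]
    have h1 := S.energy_add (w n) (⟨u, hmem⟩ - w n)
    rw [add_sub_cancel, h0] at h1
    have h2 : (⟨u, hmem⟩ - w n : S.F) = (v - w n) + ⟨_, S.const_mem r⟩ := by
      ext x; simp [hr x]; ring
    rw [h2, S.energy_add, S.energy_const_right, S.energy_const, S.energy_sub,
      S.symm v (w n)] at h1
    rw [S.energy_sub]
    linarith
  have h3 : Tendsto (fun n => S.E ⟨u, hmem⟩ ⟨u, hmem⟩ - S.E (w n - v) (w n - v)) atTop
      (𝓝 (S.E ⟨u, hmem⟩ ⟨u, hmem⟩ - 0)) := hv.const_sub _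
  rw [sub_zero] at h3
  refine h3.congr fun n => ?_
  rw [hdiff n, hE n]; ring

theorem tendsto_traceEnergy (u : S.F) :
    Tendsto (fun m => S.traceEnergy (V.set m) u.1) atTop (𝓝 (S.E u u)) := by
  obtain ⟨_, h⟩ := S.mem_of_bounded V u.1 (S.continuous_of_mem u) (S.E u u)
    fun m => S.traceEnergy_le u fun _ _ => rfl
  exact h

theorem tendsto_discreteSum_deriv (a b : S.F) :
    Tendsto (fun m => S.discreteSum V m (univDeriv a.1 * univDeriv b.1)) atTop (𝓝 (S.E a b)) := by
  have h := ((S.tendsto_traceEnergy V (a + b)).sub (S.tendsto_traceEnergy V (a - b))).const_mul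
    (1 / 4 : ℝ)
  have e : 1 / 4 * (S.E (a + b) (a + b) - S.E (a - b) (a - b)) = S.E a b := by
    rw [S.energy_add, S.energy_sub]; ring
  rw [e] at h
  refine h.congr fun m => ?_
  rw [← S.discreteSum_sq V, ← S.discreteSum_sq V]
  have e2 : univDeriv (a + b : S.F).1 * univDeriv (a + b : S.F).1
      = univDeriv (a - b : S.F).1 * univDeriv (a - b : S.F).1
        + (4 : ℝ) • (univDeriv a.1 * univDeriv b.1) := by
    ext x y
    simp [univDeriv]; ring
  rw [e2, S.discreteSum_add, S.discreteSum_smul]; ring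

theorem bounded_of_core (f : S.core) : ∃ A : ℝ, 0 ≤ A ∧ ∀ x, |f.1 x| ≤ A := by
  obtain ⟨A, hA⟩ := f.2.2.2.exists_bound_of_continuous f.2.2.1
  exact ⟨max A 0, le_max_right _ _, fun x => (hA x).trans (le_max_left _ _)⟩

theorem bounded_of_Cc (g : C_c(X, ℝ)) : ∃ A : ℝ, 0 ≤ A ∧ ∀ x, |g x| ≤ A := by
  obtain ⟨A, hA⟩ := g.hasCompactSupport'.exists_bound_of_continuous g.continuous
  exact ⟨max A 0, le_max_right _ _, fun x => (hA x).trans (le_max_left _ _)⟩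

/-- `F ∩ C_c(X)` is an algebra. -/
theorem mul_mem_core (V : ExhaustingSequence X) (f g : S.core) : f.1 * g.1 ∈ S.core := by
  obtain ⟨A, hA0, hA⟩ := S.bounded_of_core f
  obtain ⟨B, hB0, hB⟩ := S.bounded_of_core g
  have hc : Continuous (f.1 * g.1) := f.2.2.1.mul g.2.2.1
  obtain ⟨h, -⟩ := S.mem_of_bounded V (f.1 * g.1) hc
    (2 * A ^ 2 * S.energy g + 2 * B ^ 2 * S.energy f) (by
      intro m
      have h1 : S.traceEnergy (V.set m) g.1 ≤ S.energy g :=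
        S.traceEnergy_le (S.toF g) fun _ _ => rfl
      have h2 : S.traceEnergy (V.set m) f.1 ≤ S.energy f :=
        S.traceEnergy_le (S.toF f) fun _ _ => rfl
      have h3 : S.traceEnergy (V.set m) (f.1 * g.1) ≤
          2 * A ^ 2 * S.traceEnergy (V.set m) g.1 + 2 * B ^ 2 * S.traceEnergy (V.set m) f.1 := by
        rw [← S.discreteSum_sq V, ← S.discreteSum_sq V, ← S.discreteSum_sq V,
          ← S.discreteSum_smul, ← S.discreteSum_smul, ← S.discreteSum_add]
        refine S.discreteSum_mono V m fun x y => ?_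
        simp only [univDeriv, Pi.mul_apply, Pi.add_apply, Pi.smul_apply, smul_eq_mul]
        have e : f.1 x * g.1 x - f.1 y * g.1 y
            = f.1 x * (g.1 x - g.1 y) + g.1 y * (f.1 x - f.1 y) := by ring
        rw [e]
        have i1 : f.1 x ^ 2 ≤ A ^ 2 := sq_le_sq.2 (by rw [abs_of_nonneg hA0]; exact hA x)
        have i2 : g.1 y ^ 2 ≤ B ^ 2 := sq_le_sq.2 (by rw [abs_of_nonneg hB0]; exact hB y)
        have j1 := mul_le_mul_of_nonneg_right i1 (sq_nonneg (g.1 x - g.1 y))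
        have j2 := mul_le_mul_of_nonneg_right i2 (sq_nonneg (f.1 x - f.1 y))
        nlinarith [sq_nonneg (f.1 x * (g.1 x - g.1 y) - g.1 y * (f.1 x - f.1 y))]
      have := mul_le_mul_of_nonneg_left h1 (by positivity : 0 ≤ 2 * A ^ 2)
      have := mul_le_mul_of_nonneg_left h2 (by positivity : 0 ≤ 2 * B ^ 2)
      linarith)
  exact ⟨h, hc, f.2.2.2.mul_right⟩

/-- A sequence of reals that is uniformly approximated by convergent sequences converges. -/
theorem exists_lim_of_approx (s : ℕ → ℝ)
    (h : ∀ ε > 0, ∃ s' : ℕ → ℝ, (∃ L, Tendsto s' atTop (𝓝 L)) ∧ ∀ m, |s m - s' m| ≤ ε) :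
    ∃ L, Tendsto s atTop (𝓝 L) := by
  refine cauchySeq_tendsto_of_complete (Metric.cauchySeq_iff.2 fun ε hε => ?_)
  obtain ⟨s', ⟨L, hL⟩, hs⟩ := h (ε / 4) (by positivity)
  obtain ⟨N, hN⟩ := Metric.cauchySeq_iff.1 hL.cauchySeq (ε / 4) (by positivity)
  refine ⟨N, fun m hm n hn => ?_⟩
  have h1 := hN m hm n hn
  rw [Real.dist_eq] at h1 ⊢
  have h2 := abs_le.1 (hs m)
  have h3 := abs_le.1 (hs n)
  have h4 := abs_lt.1 h1
  rw [abs_lt]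
  constructor <;> linarith

theorem discreteSum_abs_le (m : ℕ) (g₁ g₂ : X → ℝ) (f₁ f₂ : S.core) (A B : ℝ)
    (h₁ : ∀ x, |g₁ x| ≤ A) (h₂ : ∀ x, |g₂ x| ≤ B) (hA : 0 ≤ A) (hB : 0 ≤ B) :
    |S.discreteSum V m (act g₁ (univDeriv f₁.1) * act g₂ (univDeriv f₂.1))|
      ≤ A * B * ((S.energy f₁ + S.energy f₂) / 2) := by
  have e₁ : S.traceEnergy (V.set m) f₁.1 ≤ S.energy f₁ :=
    S.traceEnergy_le (S.toF f₁) fun _ _ => rfl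
  have e₂ : S.traceEnergy (V.set m) f₂.1 ≤ S.energy f₂ :=
    S.traceEnergy_le (S.toF f₂) fun _ _ => rfl
  rw [← S.discreteSum_sq V] at e₁ e₂
  have hpt : ∀ x y, |(act g₁ (univDeriv f₁.1) * act g₂ (univDeriv f₂.1)) x y| ≤
      ((A * B / 2) • (univDeriv f₁.1 * univDeriv f₁.1 + univDeriv f₂.1 * univDeriv f₂.1)) x y := by
    intro x y
    simp only [act, univDeriv, Pi.mul_apply, Pi.add_apply, Pi.smul_apply, smul_eq_mul]
    have i₁ : |(g₁ x + g₁ y) / 2| ≤ A := by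
      have a := abs_le.1 (h₁ x); have b := abs_le.1 (h₁ y)
      rw [abs_le]; constructor <;> linarith
    have i₂ : |(g₂ x + g₂ y) / 2| ≤ B := by
      have a := abs_le.1 (h₂ x); have b := abs_le.1 (h₂ y)
      rw [abs_le]; constructor <;> linarith
    set a := (g₁ x + g₁ y) / 2
    set b := (g₂ x + g₂ y) / 2
    set p := f₁.1 x - f₁.1 y
    set q := f₂.1 x - f₂.1 y
    have e : |a * p * (b * q)| = (|a| * |b|) * (|p| * |q|) := by
      rw [abs_mul, abs_mul, abs_mul]; ring
    rw [e]
    have j₁ : |a| * |b| ≤ A * B := mul_le_mul i₁ i₂ (abs_nonneg _) hA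
    have j₂ : |p| * |q| ≤ (p * p + q * q) / 2 := by
      nlinarith [sq_nonneg (|p| - |q|), abs_mul_abs_self p, abs_mul_abs_self q]
    calc (|a| * |b|) * (|p| * |q|) ≤ (A * B) * ((p * p + q * q) / 2) :=
          mul_le_mul j₁ j₂ (by positivity) (by positivity)
      _ = _ := by ring
  have up := S.discreteSum_mono V m fun x y => (abs_le.1 (hpt x y)).2
  have lo := S.discreteSum_mono V m (φ := (-(A * B / 2)) •
    (univDeriv f₁.1 * univDeriv f₁.1 + univDeriv f₂.1 * univDeriv f₂.1))
    (ψ := act g₁ (univDeriv f₁.1) * act g₂ (univDeriv f₂.1)) fun x y => by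
      have := (abs_le.1 (hpt x y)).1
      simpa using this
  rw [S.discreteSum_smul, S.discreteSum_add] at up lo
  have k := mul_le_mul_of_nonneg_left (add_le_add e₁ e₂) (by positivity : 0 ≤ A * B / 2)
  rw [abs_le]
  constructor <;> linarith

theorem exists_lim_core (g₁ g₂ f₁ f₂ : S.core) :
    ∃ L, Tendsto (fun m => S.discreteSum V m
      (act g₁.1 (univDeriv f₁.1) * act g₂.1 (univDeriv f₂.1))) atTop (𝓝 L) := by
  let M : S.core → S.core → S.core := fun a b => ⟨a.1 * b.1, S.mul_mem_core V a b⟩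
  have T : ∀ a b : S.core, Tendsto (fun m => S.discreteSum V m (univDeriv a.1 * univDeriv b.1))
      atTop (𝓝 (S.E (S.toF a) (S.toF b))) := fun a b =>
    S.tendsto_discreteSum_deriv V (S.toF a) (S.toF b)
  have h := (((((((T g₁ (M g₂ (M f₁ f₂))).add (T g₂ (M g₁ (M f₁ f₂)))).add
    ((T f₁ (M g₁ (M g₂ f₂))).const_mul (-1))).add ((T f₂ (M g₁ (M g₂ f₁))).const_mul (-1))).add
    (T (M g₁ g₂) (M f₁ f₂))).add ((T (M g₁ f₁) (M g₂ f₂)).const_mul (-1))).add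
    ((T (M g₁ f₂) (M g₂ f₁)).const_mul (-1))).const_mul (-(1 / 4 : ℝ))
  refine ⟨_, h.congr fun m => ?_⟩
  simp only [← S.discreteSum_smul, ← S.discreteSum_add]
  congr 1
  ext x y
  simp only [M, act, univDeriv, Pi.mul_apply, Pi.add_apply, Pi.smul_apply, smul_eq_mul]
  ring

theorem act_sub {Y : Type u} (g g' : Y → ℝ) (ω : Y → Y → ℝ) : act (g - g') ω = act g ω - act g' ω := by
  ext x y; simp [act]; ring

theorem discreteSum_sub (m : ℕ) (φ ψ : X → X → ℝ) :
    S.discreteSum V m (φ - ψ) = S.discreteSum V m φ - S.discreteSum V m ψ := by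
  have := S.discreteSum_add V m (φ - ψ) ψ
  rw [sub_add_cancel] at this
  linarith

theorem exists_lim_generators (g₁ g₂ : C_c(X, ℝ)) (f₁ f₂ : S.core) :
    ∃ L, Tendsto (fun m => S.discreteSum V m
      (act g₁ (univDeriv f₁.1) * act g₂ (univDeriv f₂.1))) atTop (𝓝 L) := by
  have hE : 0 ≤ (S.energy f₁ + S.energy f₂) / 2 := by
    have := S.nonneg (S.toF f₁)
    have := S.nonneg (S.toF f₂)
    unfold energy; linarith
  set e := (S.energy f₁ + S.energy f₂) / 2
  have step : ∀ g₁ : S.core, ∃ L, Tendsto (fun m => S.discreteSum V m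
      (act g₁.1 (univDeriv f₁.1) * act g₂ (univDeriv f₂.1))) atTop (𝓝 L) := by
    intro g₁
    obtain ⟨A, hA0, hA⟩ := S.bounded_of_core g₁
    refine exists_lim_of_approx _ fun ε hε => ?_
    have hη : 0 < ε / (A * e + 1) := by positivity
    obtain ⟨k, hkF, hkc, hks, hk⟩ := S.regular g₂ _ hη
    refine ⟨_, S.exists_lim_core V g₁ ⟨k, hkF, hkc, hks⟩ f₁ f₂, fun m => ?_⟩
    rw [← S.discreteSum_sub, ← mul_sub, ← act_sub]
    refine (S.discreteSum_abs_le V m _ _ f₁ f₂ A (ε / (A * e + 1)) hA ?_ hA0 hη.le).trans ?_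
    · intro x; rw [Pi.sub_apply, abs_sub_comm]; exact (hk x).le
    · have : A * (ε / (A * e + 1)) * e = ε * (A * e / (A * e + 1)) := by ring
      rw [this]
      exact mul_le_of_le_one_right hε.le ((div_le_one (by positivity)).2 (by linarith))
  obtain ⟨A, hA0, hA⟩ := bounded_of_Cc g₂
  refine exists_lim_of_approx _ fun ε hε => ?_
  have hη : 0 < ε / (A * e + 1) := by positivity
  obtain ⟨k, hkF, hkc, hks, hk⟩ := S.regular g₁ _ hη
  refine ⟨_, step ⟨k, hkF, hkc, hks⟩, fun m => ?_⟩
  rw [← S.discreteSum_sub, ← sub_mul, ← act_sub]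
  refine (S.discreteSum_abs_le V m _ _ f₁ f₂ (ε / (A * e + 1)) A ?_ hA hη.le hA0).trans ?_
  · intro x; rw [Pi.sub_apply, abs_sub_comm]; exact (hk x).le
  · have : ε / (A * e + 1) * A * e = ε * (A * e / (A * e + 1)) := by ring
    rw [this]
    exact mul_le_of_le_one_right hε.le ((div_le_one (by positivity)).2 (by linarith))

theorem exists_lim_omega {ω η : X → X → ℝ} (hω : ω ∈ S.omega) (hη : η ∈ S.omega) :
    ∃ L, Tendsto (fun m => S.discreteSum V m (ω * η)) atTop (𝓝 L) := by
  have zero : ∃ L, Tendsto (fun m => S.discreteSum V m 0) atTop (𝓝 L) :=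
    ⟨0, by simp [discreteSum]⟩
  induction hω using Submodule.span_induction with
  | zero => simpa using zero
  | add a b _ _ ha hb =>
    obtain ⟨L, hL⟩ := ha
    obtain ⟨L', hL'⟩ := hb
    exact ⟨_, (hL.add hL').congr fun m => by rw [← S.discreteSum_add, add_mul]⟩
  | smul r a _ ha =>
    obtain ⟨L, hL⟩ := ha
    exact ⟨_, (hL.const_mul r).congr fun m => by rw [← S.discreteSum_smul, smul_mul_assoc]⟩
  | mem a ha =>
    obtain ⟨g₁, f₁, rfl⟩ := ha
    induction hη using Submodule.span_induction with
    | zero => simpa using zero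
    | add a b _ _ ha hb =>
      obtain ⟨L, hL⟩ := ha
      obtain ⟨L', hL'⟩ := hb
      exact ⟨_, (hL.add hL').congr fun m => by rw [← S.discreteSum_add, mul_add]⟩
    | smul r a _ ha =>
      obtain ⟨L, hL⟩ := ha
      exact ⟨_, (hL.const_mul r).congr fun m => by rw [← S.discreteSum_smul, mul_smul_comm]⟩
    | mem b hb =>
      obtain ⟨g₂, f₂, rfl⟩ := hb
      exact S.exists_lim_generators V g₁ g₂ f₁ f₂

/-- The semidefinite inner product on `omega`, as the limit of the discrete sums. -/
def omegaInner (ω η : S.omega) : ℝ :=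
  limUnder atTop fun m => S.discreteSum V m (ω.1 * η.1)

theorem tendsto_omegaInner (ω η : S.omega) :
    Tendsto (fun m => S.discreteSum V m (ω.1 * η.1)) atTop (𝓝 (S.omegaInner V ω η)) :=
  tendsto_nhds_limUnder (S.exists_lim_omega V ω.2 η.2)

/-- The space `omega`, to be endowed with the seminorm of `omegaInner`. -/
def OneForm (_V : ExhaustingSequence X) : Type u := S.omega

instance : AddCommGroup (S.OneForm V) := inferInstanceAs (AddCommGroup S.omega)

instance : Module ℝ (S.OneForm V) := inferInstanceAs (Module ℝ S.omega)

/-- The inner product structure given by `omegaInner`. -/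
abbrev oneFormCore : PreInnerProductSpace.Core ℝ (S.OneForm V) where
  inner := S.omegaInner V
  conj_inner_symm ω η := by
    simp only [omegaInner, mul_comm, conj_trivial]
  re_inner_nonneg ω := by
    refine ge_of_tendsto' (S.tendsto_omegaInner V ω ω) fun m => ?_
    have := S.discreteSum_mono V m (φ := 0) (ψ := ω.1 * ω.1) fun x y => mul_self_nonneg _
    simpa [discreteSum] using this
  add_left ω η ζ := by
    refine tendsto_nhds_unique (S.tendsto_omegaInner V (ω + η : S.omega) ζ)
      (((S.tendsto_omegaInner V ω ζ).add (S.tendsto_omegaInner V η ζ)).congr fun m => ?_)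
    rw [← S.discreteSum_add, ← add_mul]; rfl
  smul_left ω η r := by
    refine tendsto_nhds_unique (S.tendsto_omegaInner V (r • ω : S.omega) η)
      (((S.tendsto_omegaInner V ω η).const_mul r).congr fun m => ?_)
    rw [← S.discreteSum_smul, ← smul_mul_assoc]; rfl

instance : SeminormedAddCommGroup (S.OneForm V) :=
  InnerProductSpace.Core.toSeminormedAddCommGroup (c := S.oneFormCore V)

instance : InnerProductSpace ℝ (S.OneForm V) := InnerProductSpace.ofCore (S.oneFormCore V)

/-- The Hilbert space `H` of generalized `L²` vector fields: the completion of `omega`, modulo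
the elements of zero seminorm. -/
abbrev VecField : Type u := UniformSpace.Completion (S.OneForm V)

theorem norm_sq_oneForm (ω : S.OneForm V) : ‖ω‖ ^ 2 = S.omegaInner V ω ω := by
  rw [← real_inner_self_eq_norm_sq]; rfl

theorem univDeriv_mem [ProperSpace X] (f : S.core) :
    univDeriv f.1 ∈ S.omega := by
  obtain ⟨h, h1, -, hs, -⟩ := exists_continuous_one_zero_of_isCompact (s := tsupport f.1)
    (t := ∅) f.2.2.2 isClosed_empty (Set.disjoint_empty _)
  let h2 : C_c(X, ℝ) := ⟨(2 : ℝ) • h, hs.smul_left (f := fun _ => (2 : ℝ))⟩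
  obtain ⟨k, hkF, hkc, hks, hk⟩ := S.regular h2 1 one_pos
  obtain ⟨hχ, -⟩ := S.markov ⟨k, hkF⟩
  let χ : S.core := ⟨_, hχ, S.continuous_of_mem ⟨_, hχ⟩,
    hks.comp_left (g := fun t : ℝ => max 0 (min 1 t)) (by simp)⟩
  have hone : ∀ x, f.1 x ≠ 0 → χ.1 x = 1 := by
    intro x hx
    have e : h2 x = 2 := by
      have : h x = 1 := h1 (subset_tsupport _ hx)
      simp [h2, this]
    have := hk x
    rw [e, abs_lt] at this
    have : 1 ≤ k x := by linarith
    simp [χ, this]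
  have hprod : ∀ x, χ.1 x * f.1 x = f.1 x := by
    intro x
    by_cases hx : f.1 x = 0
    · simp [hx]
    · simp [hone x hx]
  have e : univDeriv f.1 = act (S.toCc f) (univDeriv χ.1) + act (S.toCc χ) (univDeriv f.1) := by
    ext x y
    have a := hprod x
    have b := hprod y
    change f.1 x - f.1 y = (f.1 x + f.1 y) / 2 * (χ.1 x - χ.1 y)
      + (χ.1 x + χ.1 y) / 2 * (f.1 x - f.1 y)
    linear_combination (-1 : ℝ) * a + b
  rw [e]
  exact Submodule.add_mem _ (Submodule.subset_span ⟨_, _, rfl⟩) (Submodule.subset_span ⟨_, _, rfl⟩)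

/-- The universal derivation `d_u f` of `f ∈ F ∩ C_c(X)`, as an element of `omega`. -/
def oneFormOf [ProperSpace X] (f : S.core) : S.OneForm V :=
  (⟨univDeriv f.1, S.univDeriv_mem f⟩ : S.omega)

/-- The derivation `∂ : F ∩ C_c(X) → H`. -/
def grad [ProperSpace X] (f : S.core) : S.VecField V :=
  (S.oneFormOf V f : UniformSpace.Completion (S.OneForm V))

theorem norm_grad_sq [ProperSpace X] (f : S.core) : ‖S.grad V f‖ ^ 2 = S.energy f := by
  rw [grad, UniformSpace.Completion.norm_coe, norm_sq_oneForm]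
  exact tendsto_nhds_unique (S.tendsto_omegaInner V _ _)
    (S.tendsto_discreteSum_deriv V (S.toF f) (S.toF f))

theorem act_mem (V : ExhaustingSequence X) (g : S.core) {ω : X → X → ℝ} (hω : ω ∈ S.omega) :
    act g.1 ω ∈ S.omega := by
  induction hω using Submodule.span_induction with
  | zero =>
    have : act g.1 (0 : X → X → ℝ) = 0 := by ext x y; simp [act]
    rw [this]; exact Submodule.zero_mem _
  | add a b _ _ ha hb =>
    have : act g.1 (a + b) = act g.1 a + act g.1 b := by ext x y; simp [act]; ring
    rw [this]; exact Submodule.add_mem _ ha hb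
  | smul r a _ ha =>
    have : act g.1 (r • a) = r • act g.1 a := by ext x y; simp [act]; ring
    rw [this]; exact Submodule.smul_mem _ r ha
  | mem a ha =>
    obtain ⟨k, f, rfl⟩ := ha
    let gk : C_c(X, ℝ) := S.toCc g * k
    let kf : C_c(X, ℝ) := k * S.toCc f
    let gf : S.core := ⟨g.1 * f.1, S.mul_mem_core V g f⟩
    have e : act g.1 (act k (univDeriv f.1)) = (1 / 2 : ℝ) • (act gk (univDeriv f.1)
        + act k (univDeriv gf.1) - act kf (univDeriv g.1)) := by
      ext x y
      change (g.1 x + g.1 y) / 2 * ((k x + k y) / 2 * (f.1 x - f.1 y)) =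
        1 / 2 * ((g.1 x * k x + g.1 y * k y) / 2 * (f.1 x - f.1 y)
          + (k x + k y) / 2 * (g.1 x * f.1 x - g.1 y * f.1 y)
          - (k x * f.1 x + k y * f.1 y) / 2 * (g.1 x - g.1 y))
      ring
    rw [e]
    exact Submodule.smul_mem _ _ (Submodule.sub_mem _ (Submodule.add_mem _
      (Submodule.subset_span ⟨_, _, rfl⟩) (Submodule.subset_span ⟨_, _, rfl⟩))
      (Submodule.subset_span ⟨_, _, rfl⟩))

/-- The action of `g ∈ F ∩ C_c(X)` on `omega`, as a linear map. -/
def actLinear (g : S.core) : S.OneForm V →ₗ[ℝ] S.OneForm V where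
  toFun ω := (⟨act g.1 ω.1, S.act_mem V g ω.2⟩ : S.omega)
  map_add' ω η := Subtype.ext (by
    ext x y
    change (g.1 x + g.1 y) / 2 * (ω.1 x y + η.1 x y)
      = (g.1 x + g.1 y) / 2 * ω.1 x y + (g.1 x + g.1 y) / 2 * η.1 x y
    ring)
  map_smul' r ω := Subtype.ext (by
    ext x y
    change (g.1 x + g.1 y) / 2 * (r * ω.1 x y) = r * ((g.1 x + g.1 y) / 2 * ω.1 x y)
    ring)

theorem norm_act_le (g : S.core) (A : ℝ) (hA0 : 0 ≤ A) (hA : ∀ x, |g.1 x| ≤ A)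
    (ω : S.OneForm V) : ‖S.actLinear V g ω‖ ≤ A * ‖ω‖ := by
  refine le_of_sq_le_sq ?_ (mul_nonneg hA0 (norm_nonneg _))
  rw [mul_pow, norm_sq_oneForm, norm_sq_oneForm]
  refine le_of_tendsto_of_tendsto' (S.tendsto_omegaInner V _ _)
    ((S.tendsto_omegaInner V ω ω).const_mul (A ^ 2)) fun m => ?_
  rw [← S.discreteSum_smul]
  refine S.discreteSum_mono V m fun x y => ?_
  change (g.1 x + g.1 y) / 2 * ω.1 x y * ((g.1 x + g.1 y) / 2 * ω.1 x y)
    ≤ A ^ 2 * (ω.1 x y * ω.1 x y)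
  have a := abs_le.1 (hA x)
  have b := abs_le.1 (hA y)
  have h : ((g.1 x + g.1 y) / 2) ^ 2 ≤ A ^ 2 :=
    sq_le_sq' (by linarith) (by linarith)
  nlinarith [mul_le_mul_of_nonneg_right h (mul_self_nonneg (ω.1 x y))]

/-- The action `v ↦ g · v` of `g ∈ F ∩ C_c(X)` on the space `H`. -/
def action (g : S.core) : S.VecField V →L[ℝ] S.VecField V :=
  ((S.actLinear V g).mkContinuousOfExistsBound (by
    obtain ⟨A, hA0, hA⟩ := S.bounded_of_core g
    exact ⟨A, S.norm_act_le V g A hA0 hA⟩)).completion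

section Forms

variable [MeasurableSpace X] (μ : Measure X)

/-- The sequence `f_n ∈ F ∩ C_c(X)` is Cauchy with respect to `E` and converges to `u` in
`L²(X, μ)`. -/
def IsApprox (f : ℕ → S.core) (u : Lp ℝ 2 μ) : Prop :=
  Tendsto (fun n => eLpNorm (fun x => (f n).1 x - u x) 2 μ) atTop (𝓝 0) ∧
    ∀ ε > 0, ∃ N, ∀ m ≥ N, ∀ n ≥ N, S.energy (f m - f n) < ε

/-- The domain `D(E)` of the closure of `(E, F ∩ C_c(X))` on `L²(X, μ)`. -/
def domain : Set (Lp ℝ 2 μ) := {u | ∃ f : ℕ → S.core, S.IsApprox μ f u}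

/-- `r` is the value at `(u, v)` of the extension by continuity of `q` from `F ∩ C_c(X)`
to `D(E)`. -/
def IsClosureValue (q : S.core → S.core → ℝ) (u v : Lp ℝ 2 μ) (r : ℝ) : Prop :=
  ∀ f g : ℕ → S.core, S.IsApprox μ f u → S.IsApprox μ g v →
    Tendsto (fun n => q (f n) (g n)) atTop (𝓝 r)

open Classical in
/-- The closure of the bilinear form `q` on `F ∩ C_c(X)`, as a form on `D(E)`
(with the value `0` where the extension by continuity does not exist). -/
def closureForm (q : S.core → S.core → ℝ) (u v : Lp ℝ 2 μ) : ℝ :=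
  if h : ∃ r, S.IsClosureValue μ q u v r then h.choose else 0

/-- The graph of the generator `L` of the form `q` on `D(E)`: the pairs `(u, L u)`, where
`u ∈ D(E)` and `q(u, v) = - ⟨L u, v⟩` for all `v ∈ D(E)`. -/
def generator (q : S.core → S.core → ℝ) : Set (Lp ℝ 2 μ × Lp ℝ 2 μ) :=
  {p | p.1 ∈ S.domain μ ∧ ∀ v ∈ S.domain μ, S.closureForm μ q p.1 v = - inner ℝ p.2 v}

/-- The Hardy condition on `b` with constants `δ` and `γ`. -/
def Hardy [ProperSpace X] (b : S.VecField V) (δ γ : ℝ) : Prop :=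
  0 < δ ∧ 0 ≤ γ ∧
    ∀ g : S.core, ‖S.action V g b‖ ^ 2 ≤ δ * S.energy g + γ * ∫ x, g.1 x ^ 2 ∂μ

/-- Symmetry and uniform ellipticity of `a`, with constants `lam` and `Lam`. -/
def IsUniformlyElliptic (a : S.VecField V →L[ℝ] S.VecField V) (lam Lam : ℝ) : Prop :=
  (∀ v w, inner ℝ (a v) w = inner ℝ v (a w)) ∧ 0 < lam ∧ lam < Lam ∧
    ∀ v, lam * ‖v‖ ^ 2 ≤ inner ℝ (a v) v ∧ inner ℝ (a v) v ≤ Lam * ‖v‖ ^ 2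

/-- The bilinear form `Q(f, g) = ⟨a ∂f, ∂g⟩ - ⟨g · b, ∂f⟩ - ⟨f · b', ∂g⟩ - ⟨c f, g⟩` on
`F ∩ C_c(X)`. -/
def formQ [ProperSpace X] (a : S.VecField V →L[ℝ] S.VecField V) (b b' : S.VecField V)
    (c : X → ℝ) (f g : S.core) : ℝ :=
  inner ℝ (a (S.grad V f)) (S.grad V g) - inner ℝ (S.action V g b) (S.grad V f)
    - inner ℝ (S.action V f b') (S.grad V g) - ∫ x, c x * f.1 x * g.1 x ∂μ

end Forms

end RegularResistanceForm

section Semigroups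

open scoped NNReal

variable {H : Type u} [NormedAddCommGroup H] [InnerProductSpace ℝ H]

/-- A strongly continuous semigroup of contractions. -/
structure IsContractionSemigroup (T : ℝ≥0 → H →L[ℝ] H) : Prop where
  map_zero : T 0 = ContinuousLinearMap.id ℝ H
  map_add : ∀ s t, T (s + t) = (T s).comp (T t)
  norm_le : ∀ t, ‖T t‖ ≤ 1
  continuous : ∀ x, Continuous fun t => T t x

/-- The graph of the infinitesimal generator of a semigroup. -/
def semigroupGenerator (T : ℝ≥0 → H →L[ℝ] H) : Set (H × H) :=
  {p | Tendsto (fun t : ℝ≥0 => (t : ℝ)⁻¹ • (T t p.1 - p.1)) (𝓝[>] 0) (𝓝 p.2)}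

/-- The function `u` on `[0, ∞)` is a solution of the Cauchy problem `u' = L u` on `(0, ∞)`,
`u(0) = u₀`, where `L` is an operator given by its graph. -/
def IsCauchySolution (L : Set (H × H)) (u₀ : H) (u : ℝ → H) : Prop :=
  ContDiffOn ℝ 1 u (Set.Ioi 0) ∧ ContinuousOn u (Set.Ici 0) ∧
    (∀ t > 0, (u t, deriv u t) ∈ L) ∧ u 0 = u₀

/-- The sector condition
`|⟨(-L - ε) f, g⟩| ≤ K ⟨(-L - ε) f, f⟩^(1/2) ⟨(-L - ε) g, g⟩^(1/2)` for `f, g ∈ D(L)` and all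
`0 ≤ ε ≤ ε₀`, where `L` is an operator given by its graph. -/
def SectorCondition (L : Set (H × H)) (ε₀ K : ℝ) : Prop :=
  ∀ ε, 0 ≤ ε → ε ≤ ε₀ → ∀ p ∈ L, ∀ q ∈ L,
    |inner ℝ (-p.2 - ε • p.1) q.1| ≤
      K * √(inner ℝ (-p.2 - ε • p.1) p.1) * √(inner ℝ (-q.2 - ε • q.1) q.1)

end Semigroups

end

/-! The domain $\mathcal D(\mathcal E)$ is modelled by the Hilbert space $W$ = `GraphClosure`, the
closure of the pairs $(f,\partial f)$, $f\in\mathcal F\cap C_c(X)$, in $L^2\times\mathcal H$. As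
$\|\partial f\|^2=\mathcal E(f)$, its norm squared is $\mathcal E+\|\cdot\|_{L^2}^2$. The projection
$W\to L^2$ is injective because $(\mathcal E,\mathcal F\cap C_c(X))$ is closable
(`tendsto_grad_zero`), has dense range (`denseRange_coreToLp`), and its image is $\mathcal
D(\mathcal E)$ (`mem_domain_iff`).

The Hardy bounds make $\mathcal Q$ bounded in the graph norm (`abs_formQ_le`), so it extends to a
bounded bilinear form $B$ on $W$. Cauchy–Schwarz and Young turn the definitions of $\lambda_0$ and
$c_0$ into $\mathcal Q(f,f)\ge\lambda_0\mathcal E(f)+c_0\|f\|^2$ (`le_formQ`). Half of $c_0$ is kept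
for coercivity on $W$; the other half pays for the shifts $0\le\varepsilon\le c_0/2$ in the sector
condition (`formGenerator_sectorCondition`).

Lax–Milgram makes the generator of $B$ m-dissipative (`mDissipative_formGenerator`). Such an
operator generates a contraction semigroup: its Yosida approximations generate bounded semigroups
that converge strongly (`MDissipative.exists_semigroup`), and maximality identifies the generator of
the limit.

Smoothing is obtained without complexification. For $x\in D(L^2)$ the sector condition makes
$s^2\|LT_sx\|^2+\tfrac{K^2}{4}\|T_sx\|^2$ nonincreasing, whence $\|LT_tx\|\le\tfrac{K}{2t}\|x\|$
(`norm_generator_le_of_sq`); density and closedness extend this to all $x$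
(`exists_generator_norm_le`). Thus orbits solve the Cauchy problem, dissipativity gives uniqueness,
and $\mathcal Q(u(t))=-\langle\mathcal Lu(t),u(t)\rangle\le\tfrac{K}{2t}\|\mathring u\|^2$, so
$C_K=K/2$. -/

noncomputable section

/-! ### Generation of contraction semigroups by m-dissipative operators on Hilbert spaces -/

section Generation

open scoped NNReal

variable {H : Type u} [NormedAddCommGroup H] [InnerProductSpace ℝ H]

/-- An m-dissipative operator on a real Hilbert space, given by its graph. -/
structure MDissipative (L : Submodule ℝ (H × H)) : Prop where
  inner_nonpos : ∀ p ∈ L, inner ℝ p.2 p.1 ≤ 0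
  exists_resolvent : ∀ α : ℝ, 0 < α → ∀ h : H, ∃ p ∈ L, α • p.1 - p.2 = h
  -- Single-valuedness of the graph; together with the range condition it forces the domain to be
  -- dense.
  eq_zero : ∀ h : H, ((0 : H), h) ∈ L → h = 0

/-- A bounded contraction group generated by a bounded dissipative operator. -/
theorem exists_bounded_semigroup [CompleteSpace H] (A : H →L[ℝ] H)
    (hA : ∀ x, inner ℝ (A x) x ≤ 0) :
    ∃ E : ℝ → H →L[ℝ] H, (∀ x, E 0 x = x) ∧ (∀ s t x, E (s + t) x = E s (E t x)) ∧
      (∀ t x, A (E t x) = E t (A x)) ∧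
      (∀ t x, HasDerivAt (fun s => E s x) (E t (A x)) t) ∧
      ∀ t, 0 ≤ t → ∀ x, ‖E t x‖ ≤ ‖x‖ := by
  have hd : ∀ t x, HasDerivAt (fun s : ℝ => NormedSpace.exp (s • A) x)
      (NormedSpace.exp (t • A) (A x)) t := fun t x => by
    have := (hasDerivAt_exp_smul_const (𝕂 := ℝ) A t).clm_apply (hasDerivAt_const t x)
    simpa using this
  have hcomm : ∀ (t : ℝ) x, A (NormedSpace.exp (t • A) x) = NormedSpace.exp (t • A) (A x) := by
    intro t x
    have h : Commute A (NormedSpace.exp (t • A)) := ((Commute.refl A).smul_right t).exp_right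
    exact DFunLike.congr_fun h.eq x
  refine ⟨fun t => NormedSpace.exp (t • A), fun x => by simp, fun s t x => ?_, hcomm, hd, ?_⟩
  · have h : Commute (s • A) (t • A) := ((Commute.refl A).smul_right t).smul_left s
    let _ : NormedAlgebra ℚ (H →L[ℝ] H) := NormedAlgebra.restrictScalars ℚ ℝ (H →L[ℝ] H)
    change NormedSpace.exp ((s + t) • A) x = _
    rw [add_smul, NormedSpace.exp_add_of_commute h]; rfl
  · intro t ht x
    -- The derivative is $2\langle Ay,y\rangle\le0$ at $y=e^{sA}x$.
    have hmono : AntitoneOn (fun s : ℝ => ‖NormedSpace.exp (s • A) x‖ ^ 2) (Set.Ici 0) := by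
      have hder : ∀ s, HasDerivAt (fun s : ℝ => ‖NormedSpace.exp (s • A) x‖ ^ 2)
        (2 * inner ℝ (NormedSpace.exp (s • A) x) (NormedSpace.exp (s • A) (A x))) s :=
        fun s => (hd s x).norm_sq
      refine antitoneOn_of_deriv_nonpos (convex_Ici 0)
        (fun s _ => (hder s).continuousAt.continuousWithinAt)
        (fun s _ => (hder s).differentiableAt.differentiableWithinAt) fun s _ => ?_
      rw [(hder s).deriv, ← hcomm, real_inner_comm]
      linarith [hA (NormedSpace.exp (s • A) x)]
    have := hmono Set.self_mem_Ici (Set.mem_Ici.2 ht) ht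
    simp only [zero_smul, NormedSpace.exp_zero, one_apply_eq_self] at this
    exact le_of_sq_le_sq this (norm_nonneg _)

namespace MDissipative

variable {L : Submodule ℝ (H × H)} (hL : MDissipative L)
include hL

/-- Pairing $\alpha x-Lx$ with $x$ leaves at least $\alpha\|x\|^2$ by dissipativity. This gives
uniqueness and contractivity of the resolvent. -/
theorem norm_le {p : H × H} (hp : p ∈ L) {α : ℝ} :
    α * ‖p.1‖ ≤ ‖α • p.1 - p.2‖ := by
  have h1 := hL.inner_nonpos p hp
  have h2 := real_inner_le_norm (α • p.1 - p.2) p.1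
  rw [inner_sub_left, real_inner_smul_left, real_inner_self_eq_norm_sq] at h2
  rcases (norm_nonneg p.1).eq_or_lt with h | h
  · rw [← h, mul_zero]; exact norm_nonneg _
  · refine le_of_mul_le_mul_right ?_ h
    nlinarith

theorem fst_eq {p q : H × H} (hp : p ∈ L) (hq : q ∈ L) {α : ℝ} (hα : 0 < α)
    (h : α • p.1 - p.2 = α • q.1 - q.2) : p.1 = q.1 := by
  have h1 := hL.norm_le (L.sub_mem hp hq) (α := α)
  have e : α • (p - q).1 - (p - q).2 = 0 := by
    rw [← sub_eq_zero] at h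
    rw [← h]; simp only [Prod.fst_sub, Prod.snd_sub, smul_sub]; abel
  rw [e, norm_zero] at h1
  have : ‖(p - q).1‖ ≤ 0 := by
    by_contra hc
    push Not at hc
    have := mul_pos hα hc
    linarith
  exact sub_eq_zero.1 (norm_le_zero_iff.1 this)

/-- Here $J=\alpha(\alpha-L)^{-1}$, and $\alpha(J-1)=LJ$ is the Yosida approximation of $L$. It
agrees with $JL$ on the domain of $L$, so contractivity of $J$ bounds it there by $\|Lx\|$,
uniformly in $\alpha$. -/
theorem exists_resolvent_clm {α : ℝ} (hα : 0 < α) :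
    ∃ J : H →L[ℝ] H, (∀ x, (J x, α • (J x - x)) ∈ L) ∧ (∀ x, ‖J x‖ ≤ ‖x‖) ∧
      (∀ p ∈ L, J p.2 = α • (J p.1 - p.1)) ∧ ∀ p ∈ L, ‖α • (J p.1 - p.1)‖ ≤ ‖p.2‖ := by
  have h : ∀ x, ∃ z, (z, α • (z - x)) ∈ L := by
    intro x
    obtain ⟨p, hp, e⟩ := hL.exists_resolvent α hα (α • x)
    refine ⟨p.1, ?_⟩
    have : α • (p.1 - x) = p.2 := by rw [smul_sub, ← e]; abel
    rw [this]; exact hp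
  choose J hJ using h
  have huniq : ∀ x z, (z, α • (z - x)) ∈ L → z = J x := fun x z hz =>
    hL.fst_eq hz (hJ x) hα (by simp only [smul_sub]; abel)
  have hn : ∀ x, ‖J x‖ ≤ ‖x‖ := by
    intro x
    have h1 := hL.norm_le (hJ x) (α := α)
    have e : α • J x - α • (J x - x) = α • x := by simp only [smul_sub]; abel
    simp only at h1
    rw [e, norm_smul, Real.norm_of_nonneg hα.le] at h1
    exact le_of_mul_le_mul_left h1 hα
  let J' : H →ₗ[ℝ] H :=
    { toFun := J
      map_add' := fun x y => (huniq _ _ (by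
        have := L.add_mem (hJ x) (hJ y)
        convert this using 1
        ext <;> simp only [Prod.mk_add_mk]
        simp only [smul_sub, smul_add]; abel)).symm
      map_smul' := fun r x => (huniq _ _ (by
        have := L.smul_mem r (hJ x)
        convert this using 1
        ext <;> simp [smul_sub, smul_comm α r])).symm }
  have key : ∀ p ∈ L, J p.2 = α • (J p.1 - p.1) := by
    intro p hp
    refine (huniq _ _ ?_).symm
    exact L.smul_mem α (L.sub_mem (hJ p.1) hp)
  refine ⟨J'.mkContinuous 1 fun x => by simpa [J'] using hn x, hJ, hn, key, fun p hp => ?_⟩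
  have := hn p.2
  rwa [key p hp] at this

/-- If $h$ is orthogonal to the domain and $x-Lx=h$, then $0=\langle x,h\rangle\ge\|x\|^2$ by
dissipativity, so $x=0$, and single-valuedness gives $h=0$. -/
theorem dense_domain [CompleteSpace H] : Dense (Prod.fst '' (L : Set (H × H))) := by
  have e : Prod.fst '' (L : Set (H × H)) =
      (L.map (LinearMap.fst ℝ H H) : Submodule ℝ H) := rfl
  rw [e, Submodule.dense_iff_topologicalClosure_eq_top, Submodule.topologicalClosure_eq_top_iff,
    Submodule.eq_bot_iff]
  intro h hh
  obtain ⟨p, hp, e⟩ := hL.exists_resolvent 1 one_pos h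
  rw [one_smul] at e
  have h0 : inner ℝ p.1 h = 0 := (Submodule.mem_orthogonal _ _).1 hh p.1 ⟨p, hp, rfl⟩
  have h1 := hL.inner_nonpos p hp
  rw [← e, inner_sub_right, real_inner_self_eq_norm_sq, real_inner_comm] at h0
  have h2 : ‖p.1‖ ^ 2 ≤ 0 := by linarith
  have h3 : p.1 = 0 := by
    rw [← norm_eq_zero]
    exact pow_eq_zero_iff two_ne_zero |>.1 (le_antisymm h2 (sq_nonneg _))
  have h4 : p.2 = 0 := hL.eq_zero _ (by rw [← h3]; exact hp)
  rw [← e, h3, h4, sub_zero]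

/-- A family of contractions converging on the domain to the identity converges everywhere. -/
theorem tendsto_resolvent [CompleteSpace H] {J : ℕ → H →L[ℝ] H} (hn : ∀ n x, ‖J n x‖ ≤ ‖x‖)
    (hb : ∀ n : ℕ, ∀ p ∈ L, ‖((n : ℝ) + 1) • (J n p.1 - p.1)‖ ≤ ‖p.2‖) (x : H) :
    Tendsto (fun n => J n x) atTop (𝓝 x) := by
  rw [Metric.tendsto_atTop]
  intro ε hε
  obtain ⟨_, hd, p, hp, rfl⟩ := Metric.dense_iff.1 hL.dense_domain x (ε / 3) (by positivity)
  rw [Metric.mem_ball, dist_eq_norm] at hd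
  obtain ⟨N, hN⟩ := exists_nat_gt (3 * ‖p.2‖ / ε)
  refine ⟨N, fun n hnN => ?_⟩
  have h1 := hb n p hp
  have hpos : (0 : ℝ) < (n : ℝ) + 1 := by positivity
  rw [norm_smul, Real.norm_of_nonneg hpos.le] at h1
  have h2 : (N : ℝ) ≤ n := by exact_mod_cast hnN
  rw [div_lt_iff₀ hε] at hN
  have h3 : ‖J n p.1 - p.1‖ < ε / 3 := by
    by_contra hc
    push Not at hc
    have := mul_le_mul_of_nonneg_left hc hpos.le
    nlinarith
  have h4 : ‖J n (x - p.1)‖ ≤ ‖x - p.1‖ := hn n _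
  rw [norm_sub_rev] at hd
  have e : J n x - x = J n (x - p.1) + (J n p.1 - p.1) + (p.1 - x) := by
    rw [map_sub]; abel
  rw [dist_eq_norm, e]
  have h5 := norm_add₃_le (a := J n (x - p.1)) (b := J n p.1 - p.1) (c := p.1 - x)
  rw [norm_sub_rev p.1 x] at h5
  linarith

/-- Comparison of two Yosida approximations. -/
theorem yosida_sub_sq_le {α β : ℝ} (hα : 0 < α) (hβ : 0 < β) {J K : H →L[ℝ] H}
    (hJ : ∀ x, (J x, α • (J x - x)) ∈ L) (hK : ∀ x, (K x, β • (K x - x)) ∈ L)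
    {u v : ℝ → H} {C : ℝ}
    (hu : ∀ t, HasDerivAt u (α • (J (u t) - u t)) t)
    (hv : ∀ t, HasDerivAt v (β • (K (v t) - v t)) t) (h0 : u 0 = v 0)
    (hCu : ∀ t, 0 ≤ t → ‖α • (J (u t) - u t)‖ ≤ C)
    (hCv : ∀ t, 0 ≤ t → ‖β • (K (v t) - v t)‖ ≤ C) {t : ℝ} (ht : 0 ≤ t) :
    ‖u t - v t‖ ^ 2 ≤ 4 * t * (α⁻¹ + β⁻¹) * C ^ 2 := by
  have hder : ∀ s, HasDerivAt (fun s => ‖u s - v s‖ ^ 2 - 4 * s * (α⁻¹ + β⁻¹) * C ^ 2)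
      (2 * inner ℝ (u s - v s) (α • (J (u s) - u s) - β • (K (v s) - v s))
        - 4 * (α⁻¹ + β⁻¹) * C ^ 2) s := by
    intro s
    have h2 := ((((hasDerivAt_id s).const_mul 4).mul_const (α⁻¹ + β⁻¹)).mul_const (C ^ 2))
    simp only [mul_one] at h2
    exact (((hu s).sub (hv s)).norm_sq).sub h2
  have hanti : AntitoneOn (fun s => ‖u s - v s‖ ^ 2 - 4 * s * (α⁻¹ + β⁻¹) * C ^ 2)
      (Set.Ici 0) := by
    refine antitoneOn_of_deriv_nonpos (convex_Ici 0)
        (fun s _ => (hder s).continuousAt.continuousWithinAt)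
        (fun s _ => (hder s).differentiableAt.differentiableWithinAt) fun s hs => ?_
    rw [interior_Ici, Set.mem_Ioi] at hs
    rw [(hder s).deriv]
    set p := α • (J (u s) - u s) with hp
    set q := β • (K (v s) - v s) with hq
    -- Since $u=Ju-\alpha^{-1}p$ with $(Ju,p)\in L$, and likewise for $v$, dissipativity makes the
    -- pairing of $Ju-Kv$ with $p-q$ nonpositive. Only the terms with $\alpha^{-1},\beta^{-1}$
    -- remain, and they are at most $2C\cdot(\alpha^{-1}+\beta^{-1})C$.
    have e : u s - v s = (J (u s) - K (v s)) - (α⁻¹ • p - β⁻¹ • q) := by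
      rw [hp, hq, smul_smul, smul_smul, inv_mul_cancel₀ hα.ne', inv_mul_cancel₀ hβ.ne', one_smul,
        one_smul]
      abel
    have h1 := hL.inner_nonpos _ (L.sub_mem (hJ (u s)) (hK (v s)))
    simp only [Prod.fst_sub, Prod.snd_sub] at h1
    have h2 : inner ℝ (u s - v s) (p - q) ≤ -inner ℝ (p - q) (α⁻¹ • p - β⁻¹ • q) := by
      rw [e, inner_sub_left, real_inner_comm (p - q) (J (u s) - K (v s)),
        real_inner_comm (p - q) (α⁻¹ • p - β⁻¹ • q)]
      linarith
    have h3 := neg_le_of_abs_le (abs_real_inner_le_norm (p - q) (α⁻¹ • p - β⁻¹ • q))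
    have hp' : ‖p‖ ≤ C := hCu s hs.le
    have hq' : ‖q‖ ≤ C := hCv s hs.le
    have hC : 0 ≤ C := (norm_nonneg _).trans hp'
    have h4 : ‖p - q‖ ≤ 2 * C := (norm_sub_le _ _).trans (by linarith)
    have h5 : ‖α⁻¹ • p - β⁻¹ • q‖ ≤ (α⁻¹ + β⁻¹) * C := by
      refine (norm_sub_le _ _).trans ?_
      rw [norm_smul α⁻¹ p, norm_smul β⁻¹ q, Real.norm_of_nonneg (inv_pos.2 hα).le,
        Real.norm_of_nonneg (inv_pos.2 hβ).le, add_mul]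
      gcongr
    have h6 := mul_le_mul h4 h5 (norm_nonneg _) (by positivity)
    nlinarith
  have := hanti Set.self_mem_Ici (Set.mem_Ici.2 ht) ht
  simp only [h0, sub_self, norm_zero] at this
  linarith

end MDissipative
end Generation

/-! ### Generation of contraction semigroups through Yosida approximations. -/

section SemigroupExistence

open scoped NNReal

variable {H : Type u} [NormedAddCommGroup H] [InnerProductSpace ℝ H]

/-- The pointwise limit of semigroups of contractions. -/
theorem exists_limit_semigroup [CompleteSpace H] {E : ℕ → ℝ → H →L[ℝ] H} (h0 : ∀ n x, E n 0 x = x)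
    (hadd : ∀ n s t x, E n (s + t) x = E n s (E n t x))
    (hnorm : ∀ n t, 0 ≤ t → ∀ x, ‖E n t x‖ ≤ ‖x‖)
    (hC : ∀ x t, 0 ≤ t → CauchySeq fun n => E n t x) :
    ∃ T : ℝ≥0 → H →L[ℝ] H, T 0 = ContinuousLinearMap.id ℝ H ∧
      (∀ s t, T (s + t) = (T s).comp (T t)) ∧ (∀ t x, ‖T t x‖ ≤ ‖x‖) ∧
      ∀ (t : ℝ≥0) x, Tendsto (fun n => E n t x) atTop (𝓝 (T t x)) := by
  choose F hF using fun (t : ℝ≥0) (x : H) =>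
    cauchySeq_tendsto_of_complete (hC x t t.2)
  have hFn : ∀ t x, ‖F t x‖ ≤ ‖x‖ := fun t x =>
    le_of_tendsto' (hF t x).norm fun n => hnorm n t t.2 x
  let T : ℝ≥0 → H →L[ℝ] H := fun t =>
    LinearMap.mkContinuous
      { toFun := F t
        map_add' := fun x y => tendsto_nhds_unique (hF t (x + y))
          (((hF t x).add (hF t y)).congr fun n => (map_add _ _ _).symm)
        map_smul' := fun r x => tendsto_nhds_unique (hF t (r • x))
          (((hF t x).const_smul r).congr fun n => (map_smul _ _ _).symm) }
      1 (fun x => by simpa using hFn t x)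
  have hT : ∀ t x, T t x = F t x := fun t x => rfl
  refine ⟨T, ?_, ?_, hFn, hF⟩
  · ext x
    refine tendsto_nhds_unique (hF 0 x) ?_
    simp [h0]
  · intro s t
    ext x
    change F (s + t) x = F s (F t x)
    refine tendsto_nhds_unique (hF (s + t) x) ?_
    -- Strong limits of compositions exist because the outer factors are contractions.
    have h1 : Tendsto (fun n => E n s (E n t x - F t x)) atTop (𝓝 0) := by
      refine squeeze_zero_norm (fun n => hnorm n s s.2 _) ?_
      have := ((hF t x).sub_const (F t x)).norm
      simpa using this
    have h2 := h1.add (hF s (F t x))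
    rw [zero_add] at h2
    refine h2.congr fun n => ?_
    rw [map_sub, sub_add_cancel, NNReal.coe_add, hadd]

/-- Contractivity makes the orbit of $x$ a uniform limit in $t$ of orbits starting in the dense set.
-/
theorem continuous_orbit_of_dense {T : ℝ≥0 → H →L[ℝ] H} (hn : ∀ t x, ‖T t x‖ ≤ ‖x‖)
    {D : Set H} (hD : Dense D) (hc : ∀ x ∈ D, Continuous fun t => T t x) (x : H) :
    Continuous fun t => T t x := by
  refine continuous_of_uniform_approx_of_continuous fun v hv => ?_
  obtain ⟨ε, hε, hv⟩ := Metric.mem_uniformity_dist.1 hv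
  obtain ⟨y, hy, hyD⟩ := Metric.dense_iff.1 hD x ε hε
  refine ⟨fun t => T t y, hc y hyD, fun t => hv ?_⟩
  rw [dist_eq_norm, ← map_sub]
  rw [Metric.mem_ball, dist_eq_norm, norm_sub_rev] at hy
  exact (hn t _).trans_lt hy

/-- The Yosida approximations converge to a contraction semigroup. -/
theorem MDissipative.exists_semigroup [CompleteSpace H] {L : Submodule ℝ (H × H)}
    (hL : MDissipative L) :
    ∃ T : ℝ≥0 → H →L[ℝ] H, IsContractionSemigroup T ∧
      ∀ p ∈ L, ∀ t : ℝ≥0, T t p.1 - p.1 = ∫ s in (0 : ℝ)..t, T s.toNNReal p.2 := by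
  have hpos : ∀ n : ℕ, (0 : ℝ) < (n : ℝ) + 1 := fun n => by positivity
  choose J hJ hJn hJs hJb using fun n : ℕ => hL.exists_resolvent_clm (hpos n)
  let A : ℕ → H →L[ℝ] H := fun n => ((n : ℝ) + 1) • (J n - ContinuousLinearMap.id ℝ H)
  have hA : ∀ n x, A n x = ((n : ℝ) + 1) • (J n x - x) := fun n x => rfl
  have hAd : ∀ n x, inner ℝ (A n x) x ≤ 0 := by
    intro n x
    have h1 : inner ℝ (J n x) x ≤ ‖x‖ * ‖x‖ := (real_inner_le_norm _ _).trans
      (mul_le_mul_of_nonneg_right (hJn n x) (norm_nonneg _))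
    rw [hA, real_inner_smul_left, inner_sub_left, real_inner_self_eq_norm_mul_norm]
    exact mul_nonpos_of_nonneg_of_nonpos (hpos n).le (by linarith)
  choose E hE0 hEadd hEA hEd hEn using fun n => exists_bounded_semigroup (A n) (hAd n)
  have hAb : ∀ n, ∀ p ∈ L, ‖A n p.1‖ ≤ ‖p.2‖ := fun n p hp => hJb n p hp
  have hdiff : ∀ p ∈ L, ∀ t, 0 ≤ t → ∀ m n : ℕ, ‖E m t p.1 - E n t p.1‖ ^ 2 ≤
      4 * t * (((m : ℝ) + 1)⁻¹ + ((n : ℝ) + 1)⁻¹) * ‖p.2‖ ^ 2 := by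
    intro p hp t ht m n
    have hd : ∀ (n : ℕ) (t : ℝ), HasDerivAt (fun s => E n s p.1)
        (((n : ℝ) + 1) • (J n (E n t p.1) - E n t p.1)) t := by
      intro n t
      rw [← hA, hEA]; exact hEd n t p.1
    have hb : ∀ (n : ℕ) (t : ℝ), 0 ≤ t →
        ‖((n : ℝ) + 1) • (J n (E n t p.1) - E n t p.1)‖ ≤ ‖p.2‖ := by
      intro n t ht
      rw [← hA, hEA]; exact (hEn n t ht _).trans (hAb n p hp)
    exact hL.yosida_sub_sq_le (hpos m) (hpos n) (hJ m) (hJ n) (hd m) (hd n)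
      (by simp [hE0]) (hb m) (hb n) ht
  have hinv : Tendsto (fun n : ℕ => ((n : ℝ) + 1)⁻¹) atTop (𝓝 0) := by
    simpa using tendsto_one_div_add_atTop_nhds_zero_nat (𝕜 := ℝ)
  have hC1 : ∀ p ∈ L, ∀ t, 0 ≤ t → CauchySeq fun n => E n t p.1 := by
    intro p hp t ht
    refine Metric.cauchySeq_iff.2 fun ε hε => ?_
    -- The factor 8 is twice that of `hdiff`: averaging the bounds at $m$ and $n$ gives the required
    -- estimate.
    have h := (hinv.const_mul (8 * t * ‖p.2‖ ^ 2))
    rw [mul_zero] at h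
    obtain ⟨N, hN⟩ := eventually_atTop.1 (h.eventually (gt_mem_nhds (by positivity : (0:ℝ) < ε ^ 2)))
    refine ⟨N, fun m hm n hn => ?_⟩
    rw [dist_eq_norm]
    refine lt_of_pow_lt_pow_left₀ 2 hε.le ((hdiff p hp t ht m n).trans_lt ?_)
    have := hN m hm
    have := hN n hn
    linarith
  have hC : ∀ x t, 0 ≤ t → CauchySeq fun n => E n t x := by
    intro x t ht
    refine Metric.cauchySeq_iff.2 fun ε hε => ?_
    obtain ⟨_, hd, p, hp, rfl⟩ := Metric.dense_iff.1 hL.dense_domain x (ε / 4) (by positivity)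
    rw [Metric.mem_ball, dist_eq_norm, norm_sub_rev] at hd
    obtain ⟨N, hN⟩ := Metric.cauchySeq_iff.1 (hC1 p hp t ht) (ε / 2) (by positivity)
    refine ⟨N, fun m hm n hn => ?_⟩
    have h1 := hN m hm n hn
    have h2 := hEn m t ht (x - p.1)
    have h3 := hEn n t ht (x - p.1)
    rw [dist_eq_norm] at h1 ⊢
    have e : E m t x - E n t x = E m t (x - p.1) + (E m t p.1 - E n t p.1) - E n t (x - p.1) := by
      rw [map_sub, map_sub]; abel
    rw [e]
    have h4 := norm_sub_le (E m t (x - p.1) + (E m t p.1 - E n t p.1)) (E n t (x - p.1))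
    have h5 := norm_add_le (E m t (x - p.1)) (E m t p.1 - E n t p.1)
    linarith
  obtain ⟨T, hT0, hTadd, hTn, hT⟩ := exists_limit_semigroup hE0 hEadd hEn hC
  have hlip : ∀ p ∈ L, Continuous fun t => T t p.1 := by
    intro p hp
    -- The derivative of $E_n(s)x$ is $E_n(s)A_nx$, of norm at most $\|Lx\|$ for every $n$, so the
    -- Lipschitz bound survives the limit.
    have hl : LipschitzWith ‖p.2‖₊ fun t : ℝ≥0 => T t p.1 := by
      refine LipschitzWith.of_dist_le_mul fun s t => ?_
      rw [dist_eq_norm]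
      refine le_of_tendsto' ((hT s p.1).sub (hT t p.1)).norm fun n => ?_
      have := (convex_Ici (0 : ℝ)).norm_image_sub_le_of_norm_hasDerivWithin_le
        (f := fun s => E n s p.1) (fun x _ => (hEd n x p.1).hasDerivWithinAt)
        (fun x hx => (hEn n x hx _).trans (hAb n p hp)) t.2 s.2
      simpa [NNReal.dist_eq, Real.norm_eq_abs] using this
    exact hl.continuous
  have hcont := continuous_orbit_of_dense hTn hL.dense_domain
    (by rintro _ ⟨p, hp, rfl⟩; exact hlip p hp)
  refine ⟨T, ⟨hT0, hTadd, fun t => (T t).opNorm_le_bound zero_le_one fun x => by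
    simpa using hTn t x, hcont⟩, fun p hp t => ?_⟩
  -- On the domain $A_nx=J_nLx$, and $J_n\to1$ strongly.
  have hAlim : Tendsto (fun n => A n p.1) atTop (𝓝 p.2) := by
    refine (hL.tendsto_resolvent hJn hJb p.2).congr fun n => ?_
    rw [hJs n p hp]; rfl
  have hint : ∀ n, E n t p.1 - p.1 = ∫ s in (0 : ℝ)..t, E n s (A n p.1) := by
    intro n
    rw [intervalIntegral.integral_eq_sub_of_hasDerivAt (f := fun s => E n s p.1)
      (fun s _ => hEd n s p.1), hE0]
    exact (continuous_iff_continuousAt.2 fun s => (hEd n s _).continuousAt).intervalIntegrable _ _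
  have h1 : Tendsto (fun n => E n t p.1 - p.1) atTop (𝓝 (T t p.1 - p.1)) :=
    (hT t p.1).sub_const _
  refine tendsto_nhds_unique h1 ?_
  simp only [hint]
  refine intervalIntegral.tendsto_integral_filter_of_dominated_convergence (fun _ => ‖p.2‖)
    (Eventually.of_forall fun n => Continuous.aestronglyMeasurable
      (continuous_iff_continuousAt.2 fun s => (hEd n s _).continuousAt))
    (Eventually.of_forall fun n => Eventually.of_forall fun s hs => ?_)
    intervalIntegrable_const (Eventually.of_forall fun s hs => ?_)
  · rw [Set.uIoc_of_le t.coe_nonneg] at hs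
    exact (hEn n s hs.1.le _).trans (hAb n p hp)
  · rw [Set.uIoc_of_le t.coe_nonneg] at hs
    have e : (s.toNNReal : ℝ) = s := Real.coe_toNNReal _ hs.1.le
    have h2 := hT s.toNNReal p.2
    rw [e] at h2
    have h3 : Tendsto (fun n => E n s (A n p.1 - p.2)) atTop (𝓝 0) := by
      refine squeeze_zero_norm (fun n => hEn n s hs.1.le _) ?_
      have := (hAlim.sub_const p.2).norm
      simpa using this
    have h4 := h3.add h2
    rw [zero_add] at h4
    refine h4.congr fun n => ?_
    rw [map_sub, sub_add_cancel]

/-- Semigroup generators are dissipative. -/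
theorem IsContractionSemigroup.generator_nonpos {T : ℝ≥0 → H →L[ℝ] H}
    (hT : IsContractionSemigroup T) {p : H × H} (hp : p ∈ semigroupGenerator T) :
    inner ℝ p.2 p.1 ≤ 0 := by
  have h : Tendsto (fun t : ℝ≥0 => inner ℝ ((t : ℝ)⁻¹ • (T t p.1 - p.1)) p.1) (𝓝[>] 0)
      (𝓝 (inner ℝ p.2 p.1)) := Tendsto.inner hp tendsto_const_nhds
  refine le_of_tendsto' h fun t => ?_
  rw [real_inner_smul_left, inner_sub_left, real_inner_self_eq_norm_mul_norm]
  have h1 : ‖T t p.1‖ ≤ ‖p.1‖ := by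
    simpa using (T t).le_of_opNorm_le (hT.norm_le t) p.1
  have h2 : inner ℝ (T t p.1) p.1 ≤ ‖p.1‖ * ‖p.1‖ := (real_inner_le_norm _ _).trans
      (mul_le_mul_of_nonneg_right h1 (norm_nonneg _))
  exact mul_nonpos_of_nonneg_of_nonpos (by positivity) (by linarith)

theorem IsContractionSemigroup.continuous_toNNReal {T : ℝ≥0 → H →L[ℝ] H}
    (hT : IsContractionSemigroup T) (x : H) : Continuous fun s : ℝ => T s.toNNReal x :=
  (hT.continuous x).comp continuous_real_toNNReal

/-- The fundamental theorem of calculus at $0$. The integrand is continuous on all of $\mathbb R$,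
as `Real.toNNReal` makes it constant for negative times. -/
theorem IsContractionSemigroup.mem_generator_of_integral [CompleteSpace H]
    {T : ℝ≥0 → H →L[ℝ] H}
    (hT : IsContractionSemigroup T) {p : H × H}
    (h : ∀ t : ℝ≥0, T t p.1 - p.1 = ∫ s in (0 : ℝ)..t, T s.toNNReal p.2) :
    p ∈ semigroupGenerator T := by
  have hc := hT.continuous_toNNReal p.2
  have h1 : HasDerivAt (fun t => ∫ s in (0 : ℝ)..t, T s.toNNReal p.2) (T (0 : ℝ).toNNReal p.2) 0 :=
    intervalIntegral.integral_hasDerivAt_right (hc.intervalIntegrable _ _)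
      (hc.stronglyMeasurableAtFilter _ _) hc.continuousAt
  rw [Real.toNNReal_zero, hT.map_zero, hasDerivAt_iff_tendsto_slope] at h1
  have h2 : Tendsto (fun t : ℝ≥0 => (t : ℝ)) (𝓝[>] 0) (𝓝[≠] 0) := by
    refine tendsto_nhdsWithin_iff.2 ⟨?_, ?_⟩
    · exact (NNReal.continuous_coe.tendsto 0).mono_left nhdsWithin_le_nhds
    · filter_upwards [self_mem_nhdsWithin] with t ht
      exact (NNReal.coe_pos.2 ht).ne'
  refine (h1.comp h2).congr fun t => ?_
  simp [slope, h]

/-- Every m-dissipative operator generates a contraction semigroup. -/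
theorem MDissipative.exists_semigroupGenerator_eq [CompleteSpace H]
    {L : Submodule ℝ (H × H)} (hL : MDissipative L) :
    ∃ T : ℝ≥0 → H →L[ℝ] H, IsContractionSemigroup T ∧ semigroupGenerator T = L := by
  obtain ⟨T, hT, hint⟩ := hL.exists_semigroup
  have hsub : ∀ p ∈ L, p ∈ semigroupGenerator T := fun p hp =>
    hT.mem_generator_of_integral (hint p hp)
  refine ⟨T, hT, Set.Subset.antisymm (fun p hp => ?_) hsub⟩
  -- Maximality: $q\in L$ has the same image as $p$ under $1-L$. Then $q-p$ is in the dissipative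
  -- generator and has equal components, so it vanishes.
  obtain ⟨q, hq, e⟩ := hL.exists_resolvent 1 one_pos (p.1 - p.2)
  rw [one_smul] at e
  have hd : q - p ∈ semigroupGenerator T := by
    have := Tendsto.sub (hsub q hq) hp
    refine this.congr fun t => ?_
    rw [← smul_sub, Prod.fst_sub, map_sub]
    congr 1; abel
  have h1 := hT.generator_nonpos hd
  have e2 : (q - p).2 = (q - p).1 := by
    rw [Prod.fst_sub, Prod.snd_sub]
    have : q.1 = p.1 - p.2 + q.2 := by rw [← e]; abel
    rw [this]; abel
  rw [e2, real_inner_self_eq_norm_sq] at h1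
  have h3 : (q - p).1 = 0 := by
    rw [← norm_eq_zero]
    exact pow_eq_zero_iff two_ne_zero |>.1 (le_antisymm h1 (sq_nonneg _))
  have h4 : q = p := by
    rw [← sub_eq_zero]
    exact Prod.ext h3 (e2.trans h3)
  rw [← h4]; exact hq

end SemigroupExistence

/-! ### Smoothing by sectorial generators and the Cauchy problem. -/

section AnalyticSemigroup

open scoped NNReal

variable {H : Type u} [NormedAddCommGroup H] [InnerProductSpace ℝ H]

/-- Closedness from maximality: the $q\in L$ with $q_1-q_2=x-y$ must be the limit of $p_n$, since
$\|(p_n)_1-q_1\|$ is bounded by the distance between the images under $1-L$. -/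
theorem MDissipative.mem_of_tendsto {L : Submodule ℝ (H × H)} (hL : MDissipative L)
    {p : ℕ → H × H} (hp : ∀ n, p n ∈ L) {x y : H} (hx : Tendsto (fun n => (p n).1) atTop (𝓝 x))
    (hy : Tendsto (fun n => (p n).2) atTop (𝓝 y)) : (x, y) ∈ L := by
  obtain ⟨q, hq, e⟩ := hL.exists_resolvent 1 one_pos (x - y)
  rw [one_smul] at e
  have h1 : Tendsto (fun n => (p n).1 - q.1) atTop (𝓝 0) := by
    have h2 : Tendsto (fun n => ‖((p n).1 - (p n).2) - (q.1 - q.2)‖) atTop (𝓝 0) := by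
      have := ((hx.sub hy).sub_const (q.1 - q.2)).norm
      rwa [← e, sub_self, norm_zero] at this
    refine squeeze_zero_norm (fun n => ?_) h2
    have := hL.norm_le (L.sub_mem (hp n) hq) (α := 1)
    simp only [one_mul, one_smul, Prod.fst_sub, Prod.snd_sub] at this
    convert this using 2
    abel
  have h2 : x = q.1 := by
    have := tendsto_nhds_unique h1 (hx.sub_const q.1)
    exact (sub_eq_zero.1 this.symm)
  have h3 : y = q.2 := by
    rw [h2] at e
    exact (sub_right_injective e).symm
  rw [h2, h3]; exact hq

namespace IsContractionSemigroup

variable {T : ℝ≥0 → H →L[ℝ] H} (hT : IsContractionSemigroup T)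
include hT

theorem norm_apply_le (t : ℝ≥0) (x : H) : ‖T t x‖ ≤ ‖x‖ := by
  simpa using (T t).le_of_opNorm_le (hT.norm_le t) x

theorem map_mem_generator (t : ℝ≥0) {p : H × H} (hp : p ∈ semigroupGenerator T) :
    (T t p.1, T t p.2) ∈ semigroupGenerator T := by
  refine (((T t).continuous.tendsto p.2).comp hp).congr fun s => ?_
  simp only [Function.comp, map_smul, map_sub]
  rw [← ContinuousLinearMap.comp_apply, ← ContinuousLinearMap.comp_apply, ← hT.map_add,
    ← hT.map_add, add_comm]

/-- The generator controls right difference quotients at $0$ only, and the semigroup law moves them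
to $t$. They suffice for the integral formula `integral_eq`, whose differentiation yields the
two-sided derivative in `hasDerivAt`. -/
theorem hasDerivWithinAt_Ioi {p : H × H} (hp : p ∈ semigroupGenerator T) {t : ℝ} (ht : 0 ≤ t) :
    HasDerivWithinAt (fun s : ℝ => T s.toNNReal p.1) (T t.toNNReal p.2) (Set.Ioi t) t := by
  rw [hasDerivWithinAt_iff_tendsto_slope' Set.self_notMem_Ioi]
  have h1 : Tendsto (fun z : ℝ => (z - t).toNNReal) (𝓝[>] t) (𝓝[>] 0) := by
    refine tendsto_nhdsWithin_iff.2 ⟨?_, ?_⟩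
    · have : Continuous fun z : ℝ => (z - t).toNNReal := by fun_prop
      have h := this.tendsto t
      rw [sub_self, Real.toNNReal_zero] at h
      exact h.mono_left nhdsWithin_le_nhds
    · filter_upwards [self_mem_nhdsWithin] with z hz
      exact Real.toNNReal_pos.2 (sub_pos.2 hz)
  refine ((hT.map_mem_generator t.toNNReal hp).comp h1).congr' ?_
  filter_upwards [self_mem_nhdsWithin] with z hz
  have hz' : 0 ≤ z - t := (sub_pos.2 hz).le
  have e : z.toNNReal = (z - t).toNNReal + t.toNNReal := by
    rw [← Real.toNNReal_add hz' ht, sub_add_cancel]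
  rw [slope, vsub_eq_sub, e, hT.map_add, Function.comp, Real.coe_toNNReal _ hz']
  rfl

variable [CompleteSpace H]

theorem integral_eq {p : H × H} (hp : p ∈ semigroupGenerator T) {t : ℝ} (ht : 0 ≤ t) :
    ∫ s in (0 : ℝ)..t, T s.toNNReal p.2 = T t.toNNReal p.1 - p.1 := by
  rw [intervalIntegral.integral_eq_sub_of_hasDeriv_right_of_le ht
    (hT.continuous_toNNReal p.1).continuousOn
    (fun s hs => hT.hasDerivWithinAt_Ioi hp hs.1.le)
    ((hT.continuous_toNNReal p.2).intervalIntegrable _ _), Real.toNNReal_zero, hT.map_zero]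
  rfl

theorem hasDerivAt {p : H × H} (hp : p ∈ semigroupGenerator T) {t : ℝ} (ht : 0 < t) :
    HasDerivAt (fun s : ℝ => T s.toNNReal p.1) (T t.toNNReal p.2) t := by
  have hc := hT.continuous_toNNReal p.2
  have h1 : HasDerivAt (fun t => (∫ s in (0 : ℝ)..t, T s.toNNReal p.2) + p.1)
      (T t.toNNReal p.2) t :=
    (intervalIntegral.integral_hasDerivAt_right (hc.intervalIntegrable _ _)
      (hc.stronglyMeasurableAtFilter _ _) hc.continuousAt).add_const _
  refine h1.congr_of_eventuallyEq ?_
  filter_upwards [lt_mem_nhds ht] with s hs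
  rw [hT.integral_eq hp hs.le, sub_add_cancel]

variable {L : Submodule ℝ (H × H)} (hL : MDissipative L) (hgen : semigroupGenerator T = L)
include hgen

/-- The smoothing estimate on the domain of the square of a sectorial generator. -/
theorem norm_generator_le_of_sq {K : ℝ} (hK : 0 < K)
    (hsec : ∀ p ∈ L, ∀ q ∈ L, |inner ℝ (-p.2) q.1| ≤
      K * √(inner ℝ (-p.2) p.1) * √(inner ℝ (-q.2) q.1))
    {x y z : H} (hxy : (x, y) ∈ L) (hyz : (y, z) ∈ L) {t : ℝ} (ht : 0 < t) :
    ‖T t.toNNReal y‖ ≤ K / (2 * t) * ‖x‖ := by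
  have hmem : ∀ p ∈ L, p ∈ semigroupGenerator T := fun p hp => by rw [hgen]; exact hp
  have hmem' : ∀ p ∈ L, ∀ s : ℝ, (T s.toNNReal p.1, T s.toNNReal p.2) ∈ L := fun p hp s => by
    have := hT.map_mem_generator s.toNNReal (hmem p hp)
    rwa [hgen] at this
  -- The weight $K^2/4$ is chosen to complete the square below.
  have hder : ∀ s, 0 < s → HasDerivAt
      (fun s : ℝ => s ^ 2 * ‖T s.toNNReal y‖ ^ 2 + K ^ 2 / 4 * ‖T s.toNNReal x‖ ^ 2)
      (2 * s * ‖T s.toNNReal y‖ ^ 2 +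
        s ^ 2 * (2 * inner ℝ (T s.toNNReal y) (T s.toNNReal z)) +
        K ^ 2 / 4 * (2 * inner ℝ (T s.toNNReal x) (T s.toNNReal y))) s := by
    intro s hs
    have h1 := (hT.hasDerivAt (hmem _ hxy) hs).norm_sq
    have h2 := (hT.hasDerivAt (hmem _ hyz) hs).norm_sq
    have h3 := ((hasDerivAt_pow 2 s).mul h2).add (h1.const_mul (K ^ 2 / 4))
    rw [Nat.cast_ofNat, pow_one] at h3
    exact h3
  have hanti : AntitoneOn
      (fun s : ℝ => s ^ 2 * ‖T s.toNNReal y‖ ^ 2 + K ^ 2 / 4 * ‖T s.toNNReal x‖ ^ 2)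
      (Set.Ici 0) := by
    refine antitoneOn_of_deriv_nonpos (convex_Ici 0) ?_ ?_ ?_
    · exact (((continuous_id.pow 2).mul ((hT.continuous_toNNReal y).norm.pow 2)).add
        (continuous_const.mul ((hT.continuous_toNNReal x).norm.pow 2))).continuousOn
    · rw [interior_Ici]
      exact fun s hs => (hder s hs).differentiableAt.differentiableWithinAt
    · rw [interior_Ici]
      intro s hs
      have hs' : 0 < s := hs
      rw [(hder s hs).deriv]
      have hu := hmem' _ hxy s
      have hv := hmem' _ hyz s
      -- With $u=T_sx$ and $v=T_sy=Lu$, the sector condition reads $\|v\|^2\le Kab$, where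
      -- $a^2=-\langle Lu,u\rangle$ and $b^2=-\langle Lv,v\rangle$. The derivative is then at most
      -- $2sKab-2s^2b^2-\tfrac{K^2}{2}a^2=-\tfrac12(2sb-Ka)^2$.
      have h1 := hsec _ hu _ hv
      simp only [inner_neg_left, real_inner_self_eq_norm_sq, abs_neg] at h1
      rw [abs_of_nonneg (sq_nonneg _)] at h1
      rw [real_inner_comm (T s.toNNReal z), real_inner_comm (T s.toNNReal y) (T s.toNNReal x)]
      have a0 : 0 ≤ -inner ℝ (T s.toNNReal y) (T s.toNNReal x) := by
        exact neg_nonneg.2 (hT.generator_nonpos (hgen.symm.subset hu))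
      have b0 : 0 ≤ -inner ℝ (T s.toNNReal z) (T s.toNNReal y) := by
        exact neg_nonneg.2 (hT.generator_nonpos (hgen.symm.subset hv))
      have a1 := Real.sq_sqrt a0
      have b1 := Real.sq_sqrt b0
      set a := √(-inner ℝ (T s.toNNReal y) (T s.toNNReal x))
      set b := √(-inner ℝ (T s.toNNReal z) (T s.toNNReal y))
      have h2 := mul_le_mul_of_nonneg_left h1 hs'.le
      nlinarith [sq_nonneg (2 * s * b - K * a)]
  have h := hanti Set.self_mem_Ici (Set.mem_Ici.2 ht.le) ht.le
  have e0 : T (0 : ℝ).toNNReal x = x := by rw [Real.toNNReal_zero, hT.map_zero]; rfl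
  simp only [e0] at h
  have h1 : (t * ‖T t.toNNReal y‖) ^ 2 ≤ (K / 2 * ‖x‖) ^ 2 := by
    have : 0 ≤ K ^ 2 / 4 * ‖T t.toNNReal x‖ ^ 2 := by positivity
    nlinarith
  have h2 := le_of_sq_le_sq h1 (by positivity)
  rw [div_mul_eq_mul_div, le_div_iff₀ (by positivity)]
  linarith

/-- A differentiable semigroup solves the Cauchy problem. -/
theorem isCauchySolution (hsm : ∀ x (t : ℝ), 0 < t → ∃ h, (T t.toNNReal x, h) ∈ L) (x : H) :
    IsCauchySolution (L : Set (H × H)) x (fun t => T t.toNNReal x) := by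
  -- After time $s$ the orbit is that of $T_sx$, a point of the domain, hence differentiable. Below,
  -- $s=t/2$.
  have key : ∀ s : ℝ, 0 < s → ∃ h, (T s.toNNReal x, h) ∈ L ∧ ∀ t, s < t →
      HasDerivAt (fun t : ℝ => T t.toNNReal x) (T (t - s).toNNReal h) t := by
    intro s hs
    obtain ⟨h, hh⟩ := hsm x s hs
    refine ⟨h, hh, fun t hst => ?_⟩
    have h1 := hT.hasDerivAt (p := (T s.toNNReal x, h)) (by rw [hgen]; exact hh)
      (sub_pos.2 hst)
    have h2 := HasDerivAt.scomp t h1 ((hasDerivAt_id t).sub_const s)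
    rw [one_smul] at h2
    refine h2.congr_of_eventuallyEq ?_
    filter_upwards [lt_mem_nhds hst] with r hr
    simp only [Function.comp, id]
    rw [← ContinuousLinearMap.comp_apply, ← hT.map_add,
      ← Real.toNNReal_add (sub_pos.2 hr).le hs.le, sub_add_cancel]
  refine ⟨?_, (hT.continuous_toNNReal x).continuousOn, fun t ht => ?_, ?_⟩
  · rw [show (1 : WithTop ℕ∞) = 0 + 1 from (zero_add 1).symm,
      contDiffOn_succ_iff_deriv_of_isOpen isOpen_Ioi]
    refine ⟨fun t ht => ?_, by simp, ?_⟩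
    · have ht' : 0 < t := ht
      obtain ⟨h, -, hd⟩ := key (t / 2) (by positivity)
      exact (hd t (by linarith)).differentiableAt.differentiableWithinAt
    · rw [contDiffOn_zero]
      intro t ht
      have ht' : 0 < t := ht
      obtain ⟨h, -, hd⟩ := key (t / 2) (by positivity)
      refine ContinuousAt.continuousWithinAt ?_
      have hc : ContinuousAt (fun r : ℝ => T (r - t / 2).toNNReal h) t :=
        ((hT.continuous_toNNReal h).comp (continuous_id.sub continuous_const)).continuousAt
      refine hc.congr ?_
      filter_upwards [lt_mem_nhds (by linarith : t / 2 < t)] with r hr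
      exact (hd r hr).deriv.symm
  · obtain ⟨h, hh, hd⟩ := key (t / 2) (by positivity)
    rw [(hd t (by linarith)).deriv]
    have h1 := hT.map_mem_generator (t - t / 2).toNNReal (p := (T (t / 2).toNNReal x, h))
      (by rw [hgen]; exact hh)
    rw [hgen] at h1
    have e : T t.toNNReal x = T (t - t / 2).toNNReal (T (t / 2).toNNReal x) := by
      rw [← ContinuousLinearMap.comp_apply, ← hT.map_add,
        ← Real.toNNReal_add (by linarith) (by linarith), sub_add_cancel]
    change (T t.toNNReal x, _) ∈ (L : Set (H × H))
    rw [e]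
    exact h1
  · simp only [Real.toNNReal_zero, hT.map_zero]; rfl

include hL

/-- The smoothing estimate for sectorial generators. -/
theorem exists_generator_norm_le {K : ℝ} (hK : 0 < K)
    (hsec : ∀ p ∈ L, ∀ q ∈ L, |inner ℝ (-p.2) q.1| ≤
      K * √(inner ℝ (-p.2) p.1) * √(inner ℝ (-q.2) q.1))
    (x : H) {t : ℝ} (ht : 0 < t) :
    ∃ h, (T t.toNNReal x, h) ∈ L ∧ ‖h‖ ≤ K / (2 * t) * ‖x‖ := by
  have hpos : ∀ n : ℕ, (0 : ℝ) < (n : ℝ) + 1 := fun n => by positivity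
  choose J hJ hJn hJs hJb using fun n : ℕ => hL.exists_resolvent_clm (hpos n)
  have hJx := hL.tendsto_resolvent hJn hJb
  -- Applying the resolvent twice puts the approximants of $x$ in the domain of $L^2$, where the
  -- smoothing estimate is available.
  have hJJ : Tendsto (fun n => J n (J n x)) atTop (𝓝 x) := by
    have h1 : Tendsto (fun n => J n (J n x - x)) atTop (𝓝 0) := by
      refine squeeze_zero_norm (fun n => hJn n _) ?_
      have := ((hJx x).sub_const x).norm
      simpa using this
    have h2 := h1.add (hJx x)
    rw [zero_add] at h2
    refine h2.congr fun n => ?_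
    rw [map_sub, sub_add_cancel]
  let y : ℕ → H := fun n => ((n : ℝ) + 1) • (J n (J n x) - J n x)
  have h1 : ∀ n, (J n (J n x), y n) ∈ L := fun n => hJ n (J n x)
  have h2 : ∀ n, ∃ z, (y n, z) ∈ L := fun n =>
    ⟨_, L.smul_mem ((n : ℝ) + 1) (L.sub_mem (hJ n (J n x)) (hJ n x))⟩
  choose z hz using h2
  have hb : ∀ n, ‖T t.toNNReal (y n)‖ ≤ K / (2 * t) * ‖J n (J n x)‖ := fun n =>
    hT.norm_generator_le_of_sq hgen hK hsec (h1 n) (hz n) ht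
  -- The estimate applies to differences since $L$ is linear, so $LT_tJ_n^2x=T_ty_n$ is Cauchy.
  -- Closedness of $L$ then identifies its limit.
  have hdiff : ∀ m n, ‖T t.toNNReal (y m) - T t.toNNReal (y n)‖ ≤
      K / (2 * t) * ‖J m (J m x) - J n (J n x)‖ := fun m n => by
    rw [← map_sub]
    exact hT.norm_generator_le_of_sq hgen hK hsec (L.sub_mem (h1 m) (h1 n))
      (L.sub_mem (hz m) (hz n)) ht
  have hC : CauchySeq fun n => T t.toNNReal (y n) := by
    have hcs := hJJ.cauchySeq
    rw [Metric.cauchySeq_iff] at hcs ⊢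
    intro ε hε
    have hk : 0 < K / (2 * t) := by positivity
    obtain ⟨N, hN⟩ := hcs (ε / (K / (2 * t))) (by positivity)
    refine ⟨N, fun m hm n hn => ?_⟩
    have := hN m hm n hn
    rw [dist_eq_norm] at this ⊢
    rw [lt_div_iff₀ hk] at this
    linarith [hdiff m n]
  obtain ⟨h, hh⟩ := cauchySeq_tendsto_of_complete hC
  refine ⟨h, ?_, le_of_tendsto_of_tendsto' hh.norm (hJJ.norm.const_mul _) hb⟩
  refine hL.mem_of_tendsto (p := fun n => (T t.toNNReal (J n (J n x)), T t.toNNReal (y n)))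
    (fun n => ?_) (((T t.toNNReal).continuous.tendsto x).comp hJJ) hh
  have := hT.map_mem_generator t.toNNReal (p := (J n (J n x), y n)) (by rw [hgen]; exact h1 n)
  rwa [hgen] at this

end IsContractionSemigroup

/-- Uniqueness for the Cauchy problem of a dissipative operator. -/
theorem MDissipative.isCauchySolution_unique {L : Submodule ℝ (H × H)} (hL : MDissipative L)
    {x : H} {u v : ℝ → H} (hu : IsCauchySolution (L : Set (H × H)) x u)
    (hv : IsCauchySolution (L : Set (H × H)) x v) {t : ℝ} (ht : 0 ≤ t) : u t = v t := by
  have hd : ∀ w : ℝ → H, IsCauchySolution (L : Set (H × H)) x w → ∀ s, 0 < s →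
      HasDerivAt w (deriv w s) s := fun w hw s hs =>
    ((hw.1.differentiableOn one_ne_zero).differentiableAt (Ioi_mem_nhds hs)).hasDerivAt
  have hder : ∀ s, 0 < s → HasDerivAt (fun s => ‖u s - v s‖ ^ 2)
      (2 * inner ℝ (u s - v s) (deriv u s - deriv v s)) s := fun s hs =>
    ((hd u hu s hs).sub (hd v hv s hs)).norm_sq
  -- Dissipativity gives the sign of the derivative on $(0,\infty)$; continuity at $0$ brings in the
  -- common initial value.
  have hanti : AntitoneOn (fun s => ‖u s - v s‖ ^ 2) (Set.Ici 0) := by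
    refine antitoneOn_of_deriv_nonpos (convex_Ici 0) ((hu.2.1.sub hv.2.1).norm.pow 2) ?_ ?_
    · rw [interior_Ici]
      exact fun s hs => (hder s hs).differentiableAt.differentiableWithinAt
    · rw [interior_Ici]
      intro s hs
      rw [(hder s hs).deriv, real_inner_comm]
      have := hL.inner_nonpos _ (L.sub_mem (hu.2.2.1 s hs) (hv.2.2.1 s hs))
      simp only [Prod.fst_sub, Prod.snd_sub] at this
      linarith
  have h := hanti Set.self_mem_Ici (Set.mem_Ici.2 ht) ht
  simp only [hu.2.2.2, hv.2.2.2, sub_self, norm_zero] at h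
  have h1 : ‖u t - v t‖ = 0 :=
    pow_eq_zero_iff two_ne_zero |>.1 (le_antisymm (by simpa using h) (sq_nonneg _))
  exact sub_eq_zero.1 (norm_eq_zero.1 h1)

end AnalyticSemigroup

/-! ### Coercive forms on Hilbert spaces and their generators -/

section CoerciveForms

variable {H W : Type*} [NormedAddCommGroup H] [InnerProductSpace ℝ H]
  [NormedAddCommGroup W] [InnerProductSpace ℝ W]

/-- The generator on `H` of the bounded form `B` on `W`, where `W` is mapped to `H` by `J`. -/
def formGenerator (B : W →L[ℝ] W →L[ℝ] ℝ) (J : W →L[ℝ] H) : Submodule ℝ (H × H) where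
  carrier := {p | ∃ w, J w = p.1 ∧ ∀ v, B w v = -inner ℝ p.2 (J v)}
  zero_mem' := ⟨0, by simp⟩
  add_mem' := by
    rintro p q ⟨w, hw, h⟩ ⟨w', hw', h'⟩
    refine ⟨w + w', by simp [hw, hw'], fun v => ?_⟩
    rw [map_add, add_apply, h, h', Prod.snd_add, inner_add_left]
    ring
  smul_mem' := by
    rintro r p ⟨w, hw, h⟩
    refine ⟨r • w, by simp [hw], fun v => ?_⟩
    rw [map_smul, smul_apply, h, Prod.smul_snd, real_inner_smul_left,
      smul_eq_mul]
    ring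

/-- Coercivity gives dissipativity directly, and Lax–Milgram gives the range condition. Injectivity
and dense range of $J$ make the operator single-valued. -/
theorem mDissipative_formGenerator [CompleteSpace H] [CompleteSpace W]
    {B : W →L[ℝ] W →L[ℝ] ℝ} {J : W →L[ℝ] H}
    (hJ : Function.Injective J) (hd : DenseRange J) {m : ℝ} (hm : 0 < m)
    (hB : ∀ w, m * ‖w‖ ^ 2 ≤ B w w) : MDissipative (formGenerator B J) where
  inner_nonpos := by
    rintro p ⟨w, hw, h⟩
    have h1 := h w
    have h2 := hB w
    have : 0 ≤ m * ‖w‖ ^ 2 := by positivity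
    rw [hw] at h1
    linarith
  exists_resolvent := by
    intro α hα h
    -- The equation $\alpha x-Lx=h$ is, in weak form, $B(w,v)+\alpha\langle Jw,Jv\rangle=\langle
    -- h,Jv\rangle$ with $x=Jw$.
    let B' : W →L[ℝ] W →L[ℝ] ℝ := B +
      α • (isBoundedBilinearMap_inner (𝕜 := ℝ) (E := H)).toContinuousLinearMap.bilinearComp J J
    have hB' : ∀ w v, B' w v = B w v + α * inner ℝ (J w) (J v) := fun w v => rfl
    have hc : IsCoercive B' := ⟨m, hm, fun w => by
      rw [hB', real_inner_self_eq_norm_sq]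
      have := hB w
      have : 0 ≤ α * ‖J w‖ ^ 2 := by positivity
      nlinarith⟩
    let w := hc.continuousLinearEquivOfBilin.symm (ContinuousLinearMap.adjoint J h)
    have hw : ∀ v, B' w v = inner ℝ h (J v) := fun v => by
      rw [← hc.continuousLinearEquivOfBilin_apply, ContinuousLinearEquiv.apply_symm_apply,
        ContinuousLinearMap.adjoint_inner_left]
    refine ⟨(J w, α • J w - h), ⟨w, rfl, fun v => ?_⟩, by simp⟩
    have := hw v
    rw [hB'] at this
    rw [inner_sub_left, real_inner_smul_left]
    linarith
  eq_zero := by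
    rintro h ⟨w, hw, hv⟩
    have h0 : w = 0 := hJ (by rw [hw, map_zero])
    refine hd.eq_zero_of_inner_right ℝ fun v => ?_
    have := hv v
    rw [h0, map_zero, zero_apply] at this
    rw [real_inner_comm]
    simp only at this
    linarith

/-- For $0\le\varepsilon\le\varepsilon_0$ the shifted form $B-\varepsilon\langle
J\cdot,J\cdot\rangle$ is bounded by $\|B\|+|\varepsilon_0|$ and coercive with constant $m$. The
quotient of the two bounds serves as $K$; the summand $1$ only makes it positive. -/
theorem formGenerator_sectorCondition {H : Type u} [NormedAddCommGroup H] [InnerProductSpace ℝ H]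
    {B : W →L[ℝ] W →L[ℝ] ℝ} {J : W →L[ℝ] H}
    {m ε₀ : ℝ} (hm : 0 < m) (hJ : ∀ w, ‖J w‖ ≤ ‖w‖)
    (hB : ∀ w, m * ‖w‖ ^ 2 + ε₀ * ‖J w‖ ^ 2 ≤ B w w) :
    ∃ K, 0 < K ∧ SectorCondition (formGenerator B J : Set (H × H)) ε₀ K := by
  refine ⟨(‖B‖ + |ε₀| + 1) / m, by positivity, ?_⟩
  rintro ε hε hε₀ p ⟨w, hw, h⟩ q ⟨z, hz, h'⟩
  have key : ∀ (p : H × H) (w z : W) (y : H), J w = p.1 → J z = y →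
      (∀ v, B w v = -inner ℝ p.2 (J v)) →
      inner ℝ (-p.2 - ε • p.1) y = B w z - ε * inner ℝ (J w) (J z) := by
    rintro p w z _ hw rfl h
    rw [inner_sub_left, inner_neg_left, real_inner_smul_left, h, hw]
  have low : ∀ w, m * ‖w‖ ^ 2 ≤ B w w - ε * inner ℝ (J w) (J w) := by
    intro w
    rw [real_inner_self_eq_norm_sq]
    have := hB w
    have := mul_le_mul_of_nonneg_right hε₀ (sq_nonneg ‖J w‖)
    linarith
  have sq : ∀ w, √m * ‖w‖ ≤ √(B w w - ε * inner ℝ (J w) (J w)) := by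
    intro w
    refine Real.le_sqrt_of_sq_le ?_
    rw [mul_pow, Real.sq_sqrt hm.le]
    exact low w
  rw [key p w z _ hw hz h, key p w w _ hw hw h, key q z z _ hz hz h']
  have e1 : |B w z| ≤ ‖B‖ * ‖w‖ * ‖z‖ := B.le_opNorm₂ w z
  have e2 : |inner ℝ (J w) (J z)| ≤ ‖w‖ * ‖z‖ := (abs_real_inner_le_norm _ _).trans
    (mul_le_mul (hJ w) (hJ z) (norm_nonneg _) (norm_nonneg _))
  have e3 : |B w z - ε * inner ℝ (J w) (J z)| ≤ (‖B‖ + |ε₀| + 1) * (‖w‖ * ‖z‖) := by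
    refine (abs_sub _ _).trans ?_
    rw [abs_mul, abs_of_nonneg hε]
    have e4 : ε ≤ |ε₀| := hε₀.trans (le_abs_self _)
    have e5 := mul_le_mul e4 e2 (abs_nonneg _) (abs_nonneg _)
    have e6 : 0 ≤ ‖w‖ * ‖z‖ := by positivity
    nlinarith
  refine e3.trans ?_
  have e7 := mul_le_mul (sq w) (sq z) (by positivity) (Real.sqrt_nonneg _)
  have e8 : √m * ‖w‖ * (√m * ‖z‖) = m * (‖w‖ * ‖z‖) := by
    have := Real.mul_self_sqrt hm.le
    linear_combination (‖w‖ * ‖z‖) * this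
  rw [e8] at e7
  rw [mul_assoc, div_mul_eq_mul_div, le_div_iff₀ hm]
  have e9 : 0 ≤ ‖B‖ + |ε₀| + 1 := by positivity
  nlinarith [mul_le_mul_of_nonneg_left e7 e9]

end CoerciveForms

/-! ### Extension of bounded forms and closures of graphs. -/

/-- A bounded bilinear form extends along a linear map with dense range. -/
theorem exists_bilinear_extension {D W : Type*} [AddCommGroup D] [Module ℝ D]
    [NormedAddCommGroup W] [NormedSpace ℝ W] {e : D →ₗ[ℝ] W} (hd : DenseRange e)
    (q : D →ₗ[ℝ] D →ₗ[ℝ] ℝ) {M : ℝ} (hM0 : 0 ≤ M) (hM : ∀ f g, |q f g| ≤ M * ‖e f‖ * ‖e g‖) :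
    ∃ B : W →L[ℝ] W →L[ℝ] ℝ, ∀ f g, B (e f) (e g) = q f g := by
  have hq : ∀ f, ∀ g, (q f).extendOfNorm e (e g) = q f g := fun f g =>
    LinearMap.extendOfNorm_eq hd ⟨_, hM f⟩ g
  -- The second variable is extended before the first; linearity in $f$ is checked on the dense
  -- range of $e$.
  let Q : D →ₗ[ℝ] (W →L[ℝ] ℝ) :=
    { toFun := fun f => (q f).extendOfNorm e
      map_add' := fun f g => by
        refine DFunLike.coe_injective (hd.equalizer (ContinuousLinearMap.continuous _)
          (ContinuousLinearMap.continuous _) (funext fun x => ?_))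
        change (q (f + g)).extendOfNorm e (e x) =
          (q f).extendOfNorm e (e x) + (q g).extendOfNorm e (e x)
        rw [hq, hq, hq, map_add, LinearMap.add_apply]
      map_smul' := fun r f => by
        refine DFunLike.coe_injective (hd.equalizer (ContinuousLinearMap.continuous _)
          (ContinuousLinearMap.continuous _) (funext fun x => ?_))
        change (q (r • f)).extendOfNorm e (e x) = r • (q f).extendOfNorm e (e x)
        rw [hq, hq, map_smul, LinearMap.smul_apply] }
  have hQ : ∀ f, ‖Q f‖ ≤ M * ‖e f‖ := fun f =>
    LinearMap.opNorm_extendOfNorm_le hd (by positivity) (hM f)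
  let B : W →L[ℝ] W →L[ℝ] ℝ := Q.extendOfNorm e
  have hB : ∀ f, B (e f) = Q f := fun f => LinearMap.extendOfNorm_eq hd ⟨M, hQ⟩ f
  exact ⟨B, fun f g => by rw [hB]; exact hq f g⟩

section Closure

variable {D H V : Type*} [AddCommGroup D] [Module ℝ D]
  [NormedAddCommGroup H] [InnerProductSpace ℝ H]
  [NormedAddCommGroup V] [InnerProductSpace ℝ V]
  (j : D →ₗ[ℝ] H) (d : D →ₗ[ℝ] V)

/-- The map `f ↦ (j f, d f)`. -/
def graphMap : D →ₗ[ℝ] WithLp 2 (H × V) :=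
  (WithLp.linearEquiv 2 ℝ (H × V)).symm.toLinearMap ∘ₗ j.prod d

/-- The domain of the closure of the operator `j f ↦ d f`, with the graph norm. -/
abbrev GraphClosure : Submodule ℝ (WithLp 2 (H × V)) := (graphMap j d).range.topologicalClosure

/-- The map `f ↦ (j f, d f)` into the closure of the graph. -/
def toGraphClosure : D →ₗ[ℝ] GraphClosure j d :=
  (graphMap j d).codRestrict _ fun f =>
    Submodule.le_topologicalClosure _ (LinearMap.mem_range_self _ f)

/-- The first component of an element of the closure of the graph. -/
def graphFst : GraphClosure j d →L[ℝ] H :=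
  (WithLp.fstL 2 ℝ H V).comp (GraphClosure j d).subtypeL

/-- The second component of an element of the closure of the graph. -/
def graphSnd : GraphClosure j d →L[ℝ] V :=
  (WithLp.sndL 2 ℝ H V).comp (GraphClosure j d).subtypeL

@[simp] theorem graphFst_toGraphClosure (f : D) : graphFst j d (toGraphClosure j d f) = j f := rfl

@[simp] theorem graphSnd_toGraphClosure (f : D) : graphSnd j d (toGraphClosure j d f) = d f := rfl

theorem norm_sq_graphClosure (w : GraphClosure j d) :
    ‖w‖ ^ 2 = ‖graphFst j d w‖ ^ 2 + ‖graphSnd j d w‖ ^ 2 :=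
  WithLp.prod_norm_sq_eq_of_L2 w.1

theorem norm_graphFst_le (w : GraphClosure j d) : ‖graphFst j d w‖ ≤ ‖w‖ := by
  refine le_of_sq_le_sq ?_ (norm_nonneg _)
  rw [norm_sq_graphClosure]
  linarith [sq_nonneg ‖graphSnd j d w‖]

theorem norm_graphSnd_le (w : GraphClosure j d) : ‖graphSnd j d w‖ ≤ ‖w‖ := by
  refine le_of_sq_le_sq ?_ (norm_nonneg _)
  rw [norm_sq_graphClosure]
  linarith [sq_nonneg ‖graphFst j d w‖]

theorem denseRange_toGraphClosure : DenseRange (toGraphClosure j d) := by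
  intro w
  rw [Topology.IsEmbedding.subtypeVal.closure_eq_preimage_closure_image, Set.mem_preimage,
    ← Set.range_comp]
  exact w.2

theorem exists_tendsto_toGraphClosure (w : GraphClosure j d) :
    ∃ f : ℕ → D, Tendsto (fun n => toGraphClosure j d (f n)) atTop (𝓝 w) := by
  obtain ⟨x, hx, h⟩ := mem_closure_iff_seq_limit.1 (denseRange_toGraphClosure j d w)
  choose f hf using hx
  exact ⟨f, by simpa only [hf] using h⟩

theorem cauchySeq_toGraphClosure_iff {f : ℕ → D} :
    CauchySeq (fun n => toGraphClosure j d (f n)) ↔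
      CauchySeq (fun n => j (f n)) ∧ CauchySeq fun n => d (f n) := by
  constructor
  · intro h
    exact ⟨h.map (graphFst j d).uniformContinuous, h.map (graphSnd j d).uniformContinuous⟩
  · rintro ⟨h1, h2⟩
    rw [Metric.cauchySeq_iff] at *
    intro ε hε
    obtain ⟨N₁, hN₁⟩ := h1 (ε / 2) (by positivity)
    obtain ⟨N₂, hN₂⟩ := h2 (ε / 2) (by positivity)
    refine ⟨max N₁ N₂, fun m hm n hn => ?_⟩
    have a := hN₁ m (le_of_max_le_left hm) n (le_of_max_le_left hn)
    have b := hN₂ m (le_of_max_le_right hm) n (le_of_max_le_right hn)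
    rw [dist_eq_norm] at *
    refine lt_of_pow_lt_pow_left₀ 2 hε.le ?_
    rw [← map_sub, norm_sq_graphClosure, graphFst_toGraphClosure, graphSnd_toGraphClosure, map_sub,
      map_sub]
    have a' := pow_lt_pow_left₀ a (norm_nonneg _) two_ne_zero
    have b' := pow_lt_pow_left₀ b (norm_nonneg _) two_ne_zero
    nlinarith

/-- Closability: the closure of the graph is a graph. -/
theorem injective_graphFst
    (h : ∀ f : ℕ → D, Tendsto (fun n => j (f n)) atTop (𝓝 0) → CauchySeq (fun n => d (f n)) →
      Tendsto (fun n => d (f n)) atTop (𝓝 0)) : Function.Injective (graphFst j d) := by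
  refine (injective_iff_map_eq_zero _).2 fun w hw => ?_
  obtain ⟨f, hf⟩ := exists_tendsto_toGraphClosure j d w
  have h1 : Tendsto (fun n => j (f n)) atTop (𝓝 0) := by
    rw [← hw]; exact ((graphFst j d).continuous.tendsto w).comp hf
  have h2 : Tendsto (fun n => d (f n)) atTop (𝓝 (graphSnd j d w)) :=
    ((graphSnd j d).continuous.tendsto w).comp hf
  have h3 := tendsto_nhds_unique h2 (h f h1 h2.cauchySeq)
  have h4 := norm_sq_graphClosure j d w
  rw [hw, h3, norm_zero, norm_zero] at h4
  rw [← norm_eq_zero]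
  exact pow_eq_zero_iff two_ne_zero |>.1 (by simpa using h4)

end Closure

/-! ### The Dirichlet form of a regular resistance form -/

namespace RegularResistanceForm

variable {X : Type u} [MetricSpace X] (S : RegularResistanceForm X) (V : ExhaustingSequence X)

/-- The derivation `∂` as a linear map. -/
def gradLinear [ProperSpace X] : S.core →ₗ[ℝ] S.VecField V where
  toFun := S.grad V
  map_add' f g := by
    rw [grad, grad, grad, ← UniformSpace.Completion.coe_add]
    congr 1
    refine Subtype.ext ?_
    ext x y
    change f.1 x + g.1 x - (f.1 y + g.1 y) = f.1 x - f.1 y + (g.1 x - g.1 y)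
    ring
  map_smul' r f := by
    rw [grad, grad, RingHom.id_apply, ← UniformSpace.Completion.coe_smul]
    congr 1
    refine Subtype.ext ?_
    ext x y
    change r * f.1 x - r * f.1 y = r * (f.1 x - f.1 y)
    ring

@[simp] theorem gradLinear_apply [ProperSpace X] (f : S.core) :
    S.gradLinear V f = S.grad V f := rfl

theorem action_coe (g : S.core) (ω : S.OneForm V) :
    S.action V g (ω : S.VecField V) = (S.actLinear V g ω : S.VecField V) :=
  UniformSpace.Completion.map_coe (ContinuousLinearMap.uniformContinuous _) ω

/-- The map `g ↦ g · v` as a linear map. -/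
def actionLinear (v : S.VecField V) : S.core →ₗ[ℝ] S.VecField V where
  toFun g := S.action V g v
  map_add' f g := by
    induction v using UniformSpace.Completion.induction_on with
    | hp =>
      exact isClosed_eq (S.action V (f + g)).continuous (S.action V f + S.action V g).continuous
    | ih ω =>
      rw [action_coe, action_coe, action_coe, ← UniformSpace.Completion.coe_add]
      congr 1
      refine Subtype.ext ?_
      ext x y
      change (f.1 x + g.1 x + (f.1 y + g.1 y)) / 2 * ω.1 x y
        = (f.1 x + f.1 y) / 2 * ω.1 x y + (g.1 x + g.1 y) / 2 * ω.1 x y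
      ring
  map_smul' r f := by
    rw [RingHom.id_apply]
    induction v using UniformSpace.Completion.induction_on with
    | hp => exact isClosed_eq (S.action V (r • f)).continuous (r • S.action V f).continuous
    | ih ω =>
      rw [action_coe, action_coe, ← UniformSpace.Completion.coe_smul]
      congr 1
      refine Subtype.ext ?_
      ext x y
      change (r * f.1 x + r * f.1 y) / 2 * ω.1 x y = r * ((f.1 x + f.1 y) / 2 * ω.1 x y)
      ring

@[simp] theorem actionLinear_apply (v : S.VecField V) (g : S.core) :
    S.actionLinear V v g = S.action V g v := rfl

/-- Cutoff functions in `F ∩ C_c(X)`. -/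
theorem exists_cutoff [ProperSpace X] {K : Set X} (hK : IsCompact K) :
    ∃ χ : S.core, (∀ x ∈ K, χ.1 x = 1) ∧ ∀ x, |χ.1 x| ≤ 1 := by
  obtain ⟨h, h1, -, hs, -⟩ := exists_continuous_one_zero_of_isCompact (s := K)
    (t := ∅) hK isClosed_empty (Set.disjoint_empty _)
  -- An element of $\mathcal F$ within distance $1$ of $2h$ is at least $1$ on $K$, so truncation to
  -- $[0,1]$ by the Markov property makes it equal to $1$ there.
  let h2 : C_c(X, ℝ) := ⟨(2 : ℝ) • h, hs.smul_left (f := fun _ => (2 : ℝ))⟩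
  obtain ⟨k, hkF, hkc, hks, hk⟩ := S.regular h2 1 one_pos
  obtain ⟨hχ, -⟩ := S.markov ⟨k, hkF⟩
  refine ⟨⟨_, hχ, S.continuous_of_mem ⟨_, hχ⟩,
    hks.comp_left (g := fun t : ℝ => max 0 (min 1 t)) (by simp)⟩, fun x hx => ?_, fun x => ?_⟩
  · have e : h2 x = 2 := by
      have : h x = 1 := h1 hx
      simp [h2, this]
    have := hk x
    rw [e, abs_lt] at this
    have : 1 ≤ k x := by linarith
    simp [this]
  · change |max 0 (min 1 (k x))| ≤ 1
    rw [abs_of_nonneg (le_max_left _ _)]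
    exact max_le zero_le_one (min_le_left _ _)

/-! ### The space $\mathcal F\cap C_c(X)$ in $L^2(X,\mu)$: closability and density. -/

section L2

variable [MeasurableSpace X] [BorelSpace X] (μ : Measure X) [IsLocallyFiniteMeasure μ]

theorem memLp_core (f : S.core) (p : ENNReal) : MemLp f.1 p μ :=
  f.2.2.1.memLp_of_hasCompactSupport f.2.2.2

/-- The embedding of `F ∩ C_c(X)` into `L²(X, μ)`. -/
def coreToLp : S.core →ₗ[ℝ] Lp ℝ 2 μ where
  toFun f := (S.memLp_core μ f 2).toLp f.1
  map_add' _ _ := rfl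
  map_smul' _ _ := rfl

theorem coeFn_coreToLp (f : S.core) : S.coreToLp μ f =ᵐ[μ] f.1 :=
  MemLp.coeFn_toLp (S.memLp_core μ f 2)

theorem norm_coreToLp_sq (f : S.core) : ‖S.coreToLp μ f‖ ^ 2 = ∫ x, f.1 x ^ 2 ∂μ := by
  rw [← real_inner_self_eq_norm_sq, L2.inner_def]
  refine integral_congr_ae ?_
  filter_upwards [S.coeFn_coreToLp μ f] with x hx
  rw [hx, real_inner_self_eq_norm_sq, Real.norm_eq_abs, sq_abs]

theorem tendsto_coreToLp_iff {f : ℕ → S.core} {u : Lp ℝ 2 μ} :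
    Tendsto (fun n => S.coreToLp μ (f n)) atTop (𝓝 u) ↔
      Tendsto (fun n => eLpNorm (fun x => (f n).1 x - u x) 2 μ) atTop (𝓝 0) := by
  have := Lp.tendsto_Lp_iff_tendsto_eLpNorm'' (fi := atTop) (fun n => (f n).1)
    (fun n => S.memLp_core μ (f n) 2) (u : X → ℝ) (Lp.memLp u)
  rw [Lp.toLp_coeFn] at this
  exact this

/-- As $\|\partial f\|^2=\mathcal E(f)$, being $\mathcal E$-Cauchy means that the gradients are
Cauchy in $\mathcal H$. This links `IsApprox` with the graph closure. -/
theorem isApprox_iff [ProperSpace X] {f : ℕ → S.core} {u : Lp ℝ 2 μ} :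
    S.IsApprox μ f u ↔ Tendsto (fun n => S.coreToLp μ (f n)) atTop (𝓝 u) ∧
      CauchySeq fun n => S.gradLinear V (f n) := by
  rw [IsApprox, S.tendsto_coreToLp_iff μ]
  refine and_congr_right fun _ => ?_
  rw [Metric.cauchySeq_iff]
  simp only [dist_eq_norm, ← map_sub]
  simp only [gradLinear_apply, ← S.norm_grad_sq V]
  constructor
  · intro h ε hε
    obtain ⟨N, hN⟩ := h (ε ^ 2) (by positivity)
    exact ⟨N, fun m hm n hn => lt_of_pow_lt_pow_left₀ 2 hε.le (hN m hm n hn)⟩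
  · intro h ε hε
    obtain ⟨N, hN⟩ := h (√ε) (Real.sqrt_pos.2 hε)
    refine ⟨N, fun m hm n hn => ?_⟩
    have := pow_lt_pow_left₀ (hN m hm n hn) (norm_nonneg _) two_ne_zero
    rwa [Real.sq_sqrt hε.le] at this

/-- Closability of `(E, F ∩ C_c(X))` on `L²(X, μ)`. -/
theorem tendsto_grad_zero [ProperSpace X] [Nonempty X] [μ.IsOpenPosMeasure] (f : ℕ → S.core)
    (hj : Tendsto (fun n => S.coreToLp μ (f n)) atTop (𝓝 0))
    (hd : CauchySeq fun n => S.gradLinear V (f n)) :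
    Tendsto (fun n => S.gradLinear V (f n)) atTop (𝓝 0) := by
  -- Completeness modulo constants gives an energy limit $v$, along which differences of values
  -- converge. Almost everywhere convergence to $0$ of a subsequence forces $v$ to be constant
  -- almost everywhere.
  obtain ⟨v, hv⟩ := S.complete (fun n => S.toF (f n)) (fun ε hε =>
    ((S.isApprox_iff V μ).2 ⟨hj, hd⟩).2 ε hε)
  obtain ⟨ns, hns, hae⟩ := (tendstoInMeasure_of_tendsto_Lp hj).exists_seq_tendsto_ae
  have hae' : ∀ᵐ x ∂μ, Tendsto (fun i => (f (ns i)).1 x) atTop (𝓝 0) := by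
    have h0 : ((0 : Lp ℝ 2 μ) : X → ℝ) =ᵐ[μ] 0 := Lp.coeFn_zero ℝ 2 μ
    filter_upwards [hae, h0, ae_all_iff.2 fun n => S.coeFn_coreToLp μ (f n)] with x h1 h2 h3
    simpa only [h3, h2, Pi.zero_apply] using h1
  obtain ⟨x₀, hx₀⟩ := hae'.exists
  have hconst : ∀ᵐ x ∂μ, v.1 x = v.1 x₀ := by
    filter_upwards [hae'] with x hx
    have h1 := (S.tendsto_diff hv x x₀).comp hns.tendsto_atTop
    have h2 := (hx.sub_const (v.1 x)).sub (hx₀.sub_const (v.1 x₀))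
    have := tendsto_nhds_unique h1 h2
    linarith
  -- Continuity and positivity of $\mu$ on open sets make $v$ constant everywhere, so $\mathcal
  -- E(f_n)=\mathcal E(f_n-v)\to0$.
  have hconst' : v.1 = fun _ => v.1 x₀ :=
    ((S.continuous_of_mem v).ae_eq_iff_eq μ continuous_const).1 hconst
  have hvr : v = ⟨_, S.const_mem (v.1 x₀)⟩ := Subtype.ext hconst'
  have hE : ∀ n, S.E (S.toF (f n) - v) (S.toF (f n) - v) = ‖S.gradLinear V (f n)‖ ^ 2 := by
    intro n
    rw [gradLinear_apply, S.norm_grad_sq, energy, S.energy_sub, hvr, S.energy_const_right,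
      S.energy_const]
    ring
  simp only [hE] at hv
  rw [tendsto_zero_iff_norm_tendsto_zero]
  have := hv.sqrt
  simpa [Real.sqrt_sq (norm_nonneg _)] using this

/-- `F ∩ C_c(X)` is dense in `L²(X, μ)`. -/
theorem denseRange_coreToLp [ProperSpace X] (V : ExhaustingSequence X) :
    DenseRange (S.coreToLp μ) := by
  have hCc : ∀ g : X → ℝ, ∀ hg : MemLp g 2 μ, Continuous g → HasCompactSupport g →
      hg.toLp g ∈ closure (Set.range (S.coreToLp μ)) := by
    intro g hg hgc hgs
    -- Uniform approximants may have growing supports. Multiplication by $\chi$, equal to $1$ on the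
    -- support of $g$, confines the error to a fixed compact set of finite measure.
    obtain ⟨χ, h1, hle⟩ := S.exists_cutoff hgs
    have hpos : ∀ n : ℕ, (0 : ℝ) < 1 / ((n : ℝ) + 1) := fun n => Nat.one_div_pos_of_nat
    choose f hfF hfc hfs hf using fun n : ℕ => S.regular ⟨⟨g, hgc⟩, hgs⟩ _ (hpos n)
    let k : ℕ → S.core := fun n =>
      ⟨χ.1 * f n, S.mul_mem_core V χ ⟨f n, hfF n, hfc n, hfs n⟩⟩
    refine mem_closure_of_tendsto (f := fun n => S.coreToLp μ (k n)) (b := atTop) ?_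
      (Eventually.of_forall fun n => Set.mem_range_self _)
    refine (Lp.tendsto_Lp_iff_tendsto_eLpNorm'' (fun n => (k n).1)
      (fun n => S.memLp_core μ (k n) 2) g hg).2 ?_
    have hbound : ∀ n, eLpNorm ((k n).1 - g) 2 μ ≤
        ENNReal.ofReal (1 / ((n : ℝ) + 1)) * μ (tsupport χ.1) ^ (1 / (2 : ENNReal).toReal) := by
      intro n
      have e := eLpNorm_indicator_const (μ := μ) (p := 2) (c := (1 / ((n : ℝ) + 1) : ℝ))
        (isClosed_tsupport χ.1).measurableSet two_ne_zero ENNReal.ofNat_ne_top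
      rw [Real.enorm_of_nonneg (hpos n).le] at e
      rw [← e]
      refine eLpNorm_mono fun x => ?_
      have hx : χ.1 x * f n x - g x = χ.1 x * (f n x - g x) := by
        by_cases hgx : g x = 0
        · rw [hgx]; ring
        · rw [h1 x (subset_tsupport _ hgx)]; ring
      change ‖χ.1 x * f n x - g x‖ ≤ _
      rw [hx, norm_mul]
      by_cases hx : x ∈ tsupport χ.1
      · rw [Set.indicator_of_mem hx, Real.norm_of_nonneg (hpos n).le]
        have h2 : |f n x - g x| < 1 / ((n : ℝ) + 1) := hf n x
        calc ‖χ.1 x‖ * ‖f n x - g x‖ ≤ 1 * (1 / ((n : ℝ) + 1)) :=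
              mul_le_mul (hle x) h2.le (norm_nonneg _) zero_le_one
          _ = _ := one_mul _
      · rw [image_eq_zero_of_notMem_tsupport hx]; simp
    refine tendsto_of_tendsto_of_tendsto_of_le_of_le tendsto_const_nhds ?_
      (fun _ => zero_le) hbound
    have h3 : Tendsto (fun n : ℕ => ENNReal.ofReal (1 / ((n : ℝ) + 1))) atTop (𝓝 0) := by
      have := ENNReal.tendsto_ofReal (tendsto_one_div_add_atTop_nhds_zero_nat (𝕜 := ℝ))
      simpa using this
    have h4 := ENNReal.Tendsto.mul_const (b := μ (tsupport χ.1) ^ (1 / (2 : ENNReal).toReal)) h3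
      (Or.inr (ENNReal.rpow_ne_top_of_nonneg (by positivity) χ.2.2.2.measure_lt_top.ne))
    simpa using h4
  intro u
  rw [EMetric.mem_closure_iff]
  intro ε hε
  obtain ⟨δ, hδ0, hδ⟩ := exists_between hε
  obtain ⟨g, hgs, hle, hgc, hg⟩ := (Lp.memLp u).exists_hasCompactSupport_eLpNorm_sub_le
    ENNReal.ofNat_ne_top (ENNReal.half_pos hδ0.ne').ne'
  obtain ⟨w, hw, hd⟩ := EMetric.mem_closure_iff.1 (hCc g hg hgc hgs) (δ / 2)
    (ENNReal.half_pos hδ0.ne')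
  refine ⟨w, hw, ?_⟩
  have h1 : edist u (hg.toLp g) ≤ δ / 2 := by
    rw [Lp.edist_def]
    refine le_trans (le_of_eq (eLpNorm_congr_ae ?_)) hle
    filter_upwards [hg.coeFn_toLp] with x hx
    simp [hx]
  calc edist u w ≤ edist u (hg.toLp g) + edist (hg.toLp g) w := edist_triangle _ _ _
    _ ≤ δ / 2 + δ / 2 := add_le_add h1 hd.le
    _ = δ := ENNReal.add_halves δ
    _ < ε := hδ

end L2

end RegularResistanceForm

/-! ### Boundedness and coercivity of $\mathcal Q$ on $\mathcal F\cap C_c(X)$. -/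

/-- The elementary inequality behind the coercivity of forms with Hardy class drifts. -/
theorem coercivity_aux {x y p p' lam δ δ' γ γ' lam₀ κ Q : ℝ} (hx : 0 ≤ x) (hy : 0 ≤ y)
    (hδ : 0 ≤ δ) (hδ' : 0 ≤ δ') (hγ : 0 ≤ γ) (hγ' : 0 ≤ γ')
    (hp : p ^ 2 ≤ δ * x ^ 2 + γ * y ^ 2) (hp' : p' ^ 2 ≤ δ' * x ^ 2 + γ' * y ^ 2)
    (hlam : lam₀ = (lam - √δ - √δ') / 2) (hlam₀ : 0 < lam₀)
    (hQ : lam * x ^ 2 - p * x - p' * x + κ * y ^ 2 ≤ Q) :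
    lam₀ * x ^ 2 + (κ - (γ + γ') / (2 * lam₀)) * y ^ 2 ≤ Q := by
  have root : ∀ {p δ γ : ℝ}, 0 ≤ δ → 0 ≤ γ → p ^ 2 ≤ δ * x ^ 2 + γ * y ^ 2 →
      p ≤ √δ * x + √γ * y := by
    intro p δ γ hδ hγ hp
    refine le_of_sq_le_sq (hp.trans ?_) (by positivity)
    have h1 := Real.sq_sqrt hδ
    have h2 := Real.sq_sqrt hγ
    have h3 : 0 ≤ √δ * x * (√γ * y) := by positivity
    calc δ * x ^ 2 + γ * y ^ 2 = √δ ^ 2 * x ^ 2 + √γ ^ 2 * y ^ 2 := by rw [h1, h2]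
      _ ≤ _ := by nlinarith
  have h1 := mul_le_mul_of_nonneg_right (root hδ hγ hp) hx
  have h2 := mul_le_mul_of_nonneg_right (root hδ' hγ' hp') hx
  -- Young's inequality with $(\sqrt\gamma+\sqrt{\gamma'})^2\le2(\gamma+\gamma')$. It spends one of
  -- the two copies of $\lambda_0x^2$ in $(\lambda-\sqrt\delta-\sqrt{\delta'})x^2=2\lambda_0x^2$.
  have h3 : (√γ + √γ') * (x * y) ≤ lam₀ * x ^ 2 + (γ + γ') / (2 * lam₀) * y ^ 2 := by
    have e1 := Real.sq_sqrt hγ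
    have e2 := Real.sq_sqrt hγ'
    have e3 : lam₀ * ((γ + γ') / (2 * lam₀)) = (γ + γ') / 2 := by field_simp
    refine le_of_mul_le_mul_left ?_ hlam₀
    have e4 : lam₀ * (lam₀ * x ^ 2 + (γ + γ') / (2 * lam₀) * y ^ 2)
        = lam₀ ^ 2 * x ^ 2 + (γ + γ') / 2 * y ^ 2 := by rw [← e3]; ring
    rw [e4]
    have e5 := sq_nonneg (lam₀ * x - (√γ + √γ') * y / 2)
    have e6 : (√γ + √γ') ^ 2 ≤ 2 * (γ + γ') := by nlinarith [sq_nonneg (√γ - √γ')]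
    have e7 := mul_le_mul_of_nonneg_right e6 (sq_nonneg y)
    nlinarith
  have e : lam = 2 * lam₀ + √δ + √δ' := by rw [hlam]; ring
  rw [e] at hQ
  linarith

namespace RegularResistanceForm

variable {X : Type u} [MetricSpace X] (S : RegularResistanceForm X) (V : ExhaustingSequence X)
  [MeasurableSpace X] [BorelSpace X] (μ : Measure X) [IsLocallyFiniteMeasure μ]

theorem memLp_mul_core {c : X → ℝ} (hc : MemLp c ⊤ μ) (f : S.core) :
    MemLp (fun x => c x * f.1 x) 2 μ :=
  (S.memLp_core μ f 2).mul hc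

/-- Multiplication by a bounded function, from `F ∩ C_c(X)` to `L²(X, μ)`. -/
def mulCore {c : X → ℝ} (hc : MemLp c ⊤ μ) : S.core →ₗ[ℝ] Lp ℝ 2 μ where
  toFun f := (S.memLp_mul_core μ hc f).toLp _
  map_add' f g := by
    rw [← MemLp.toLp_add]
    refine MemLp.toLp_congr _ _ (Eventually.of_forall fun x => ?_)
    change c x * (f.1 x + g.1 x) = c x * f.1 x + c x * g.1 x
    ring
  map_smul' r f := by
    rw [RingHom.id_apply, ← MemLp.toLp_const_smul]
    refine MemLp.toLp_congr _ _ (Eventually.of_forall fun x => ?_)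
    change c x * (r * f.1 x) = r * (c x * f.1 x)
    ring

theorem inner_mulCore {c : X → ℝ} (hc : MemLp c ⊤ μ) (f g : S.core) :
    inner ℝ (S.mulCore μ hc f) (S.coreToLp μ g) = ∫ x, c x * f.1 x * g.1 x ∂μ := by
  rw [L2.inner_def]
  refine integral_congr_ae ?_
  filter_upwards [S.coeFn_coreToLp μ g, (S.memLp_mul_core μ hc f).coeFn_toLp] with x h1 h2
  have h3 : S.mulCore μ hc f x = c x * f.1 x := h2
  rw [h1, h3, real_inner_eq_re_inner ℝ]
  simp [mul_comm]

theorem norm_mulCore_le {c : X → ℝ} (hc : MemLp c ⊤ μ) (f : S.core) :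
    ‖S.mulCore μ hc f‖ ≤ (eLpNorm c ⊤ μ).toReal * ‖S.coreToLp μ f‖ := by
  refine Lp.norm_le_mul_norm_of_ae_le_mul ?_
  filter_upwards [S.coeFn_coreToLp μ f, (S.memLp_mul_core μ hc f).coeFn_toLp,
    ae_le_eLpNormEssSup (f := c) (μ := μ)] with x h1 h2 h3
  have h4 : S.mulCore μ hc f x = c x * f.1 x := h2
  rw [h1, h4, norm_mul]
  refine mul_le_mul_of_nonneg_right ?_ (norm_nonneg _)
  rw [← eLpNorm_exponent_top] at h3
  have := ENNReal.toReal_mono hc.2.ne h3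
  simpa using this

theorem inner_mulCore_le {c : X → ℝ} (hc : MemLp c ⊤ μ) (f : S.core) :
    inner ℝ (S.mulCore μ hc f) (S.coreToLp μ f) ≤
      -essInf (fun x => -c x) μ * ‖S.coreToLp μ f‖ ^ 2 := by
  -- A real essential infimum is an almost everywhere lower bound only for functions essentially
  -- bounded below; here $c\in L^\infty$ ensures this.
  have hbd : IsBoundedUnder (· ≥ ·) (ae μ) fun x => -c x := by
    refine ⟨-(eLpNorm c ⊤ μ).toReal, ?_⟩
    rw [eventually_map]
    filter_upwards [ae_le_eLpNormEssSup (f := c) (μ := μ)] with x h3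
    rw [← eLpNorm_exponent_top] at h3
    have h := ENNReal.toReal_mono hc.2.ne h3
    rw [toReal_enorm] at h
    exact neg_le_neg ((le_abs_self _).trans h)
  rw [S.inner_mulCore, S.norm_coreToLp_sq, ← integral_const_mul]
  have hint : Integrable (fun x => f.1 x ^ 2) μ := (S.memLp_core μ f 2).integrable_sq
  have hint' : Integrable (fun x => c x * f.1 x * f.1 x) μ :=
    MemLp.integrable_mul (S.memLp_mul_core μ hc f) (S.memLp_core μ f 2)
  refine integral_mono_ae hint' (hint.const_mul _) ?_
  filter_upwards [ae_essInf_le hbd] with x hx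
  have := mul_le_mul_of_nonneg_right hx (sq_nonneg (f.1 x))
  linarith

variable [ProperSpace X] (a : S.VecField V →L[ℝ] S.VecField V) (b b' : S.VecField V)

theorem formQ_eq {c : X → ℝ} (hc : MemLp c ⊤ μ) (f g : S.core) :
    S.formQ V μ a b b' c f g =
      inner ℝ (a (S.gradLinear V f)) (S.gradLinear V g)
        - inner ℝ (S.actionLinear V b g) (S.gradLinear V f)
        - inner ℝ (S.actionLinear V b' f) (S.gradLinear V g)
        - inner ℝ (S.mulCore μ hc f) (S.coreToLp μ g) := by
  rw [S.inner_mulCore]; rfl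

/-- The form `Q` as a bilinear map. -/
def formBilin {c : X → ℝ} (hc : MemLp c ⊤ μ) : S.core →ₗ[ℝ] S.core →ₗ[ℝ] ℝ :=
  LinearMap.mk₂ ℝ (S.formQ V μ a b b' c)
    (fun f f' g => by
      simp only [S.formQ_eq V μ a b b' hc, map_add, inner_add_left, inner_add_right]; ring)
    (fun r f g => by
      simp only [S.formQ_eq V μ a b b' hc, map_smul, real_inner_smul_left, real_inner_smul_right,
        smul_eq_mul]; ring)
    (fun f g g' => by
      simp only [S.formQ_eq V μ a b b' hc, map_add, inner_add_left, inner_add_right]; ring)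
    (fun r f g => by
      simp only [S.formQ_eq V μ a b b' hc, map_smul, real_inner_smul_left, real_inner_smul_right,
        smul_eq_mul]; ring)

variable {V} {a} {b} {b'} in
theorem Hardy.norm_sq_le {δ γ : ℝ} (h : S.Hardy V μ b δ γ) (g : S.core) :
    ‖S.actionLinear V b g‖ ^ 2 ≤ δ * ‖S.gradLinear V g‖ ^ 2 + γ * ‖S.coreToLp μ g‖ ^ 2 := by
  rw [S.norm_coreToLp_sq, gradLinear_apply, S.norm_grad_sq]
  exact h.2.2 g

variable {V} {a} {b} {b'} in
theorem Hardy.norm_le {δ γ : ℝ} (h : S.Hardy V μ b δ γ) (g : S.core) :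
    ‖S.actionLinear V b g‖ ≤
      √(δ + γ) * ‖toGraphClosure (S.coreToLp μ) (S.gradLinear V) g‖ := by
  have hδ := h.1.le
  have hγ := h.2.1
  refine le_of_sq_le_sq ((h.norm_sq_le S μ g).trans ?_) (by positivity)
  rw [mul_pow, Real.sq_sqrt (by positivity), norm_sq_graphClosure, graphFst_toGraphClosure,
    graphSnd_toGraphClosure]
  have : 0 ≤ δ * ‖S.coreToLp μ g‖ ^ 2 := by positivity
  have : 0 ≤ γ * ‖S.gradLinear V g‖ ^ 2 := by positivity
  linarith

variable {V} {a} {b} {b'}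

theorem abs_formQ_le {c : X → ℝ} (hc : MemLp c ⊤ μ) {δ δ' γ γ' : ℝ}
    (hb : S.Hardy V μ b δ γ) (hb' : S.Hardy V μ b' δ' γ') (f g : S.core) :
    |S.formQ V μ a b b' c f g| ≤ (‖a‖ + √(δ + γ) + √(δ' + γ') + (eLpNorm c ⊤ μ).toReal)
      * ‖toGraphClosure (S.coreToLp μ) (S.gradLinear V) f‖
      * ‖toGraphClosure (S.coreToLp μ) (S.gradLinear V) g‖ := by
  have d : ∀ f, ‖S.gradLinear V f‖ ≤ ‖toGraphClosure (S.coreToLp μ) (S.gradLinear V) f‖ :=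
    fun f => norm_graphSnd_le _ _ (toGraphClosure (S.coreToLp μ) (S.gradLinear V) f)
  have j : ∀ f, ‖S.coreToLp μ f‖ ≤ ‖toGraphClosure (S.coreToLp μ) (S.gradLinear V) f‖ :=
    fun f => norm_graphFst_le _ _ (toGraphClosure (S.coreToLp μ) (S.gradLinear V) f)
  have hbf := hb.norm_le S μ g
  have hbf' := hb'.norm_le S μ f
  rw [S.formQ_eq V μ a b b' hc]
  have df := d f
  have dg := d g
  have jf := j f
  have jg := j g
  set s := ‖toGraphClosure (S.coreToLp μ) (S.gradLinear V) f‖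
  set t := ‖toGraphClosure (S.coreToLp μ) (S.gradLinear V) g‖
  have hs : 0 ≤ s := norm_nonneg _
  have ht : 0 ≤ t := norm_nonneg _
  have hC : 0 ≤ (eLpNorm c ⊤ μ).toReal := ENNReal.toReal_nonneg
  have h1 : |inner ℝ (a (S.gradLinear V f)) (S.gradLinear V g)| ≤ ‖a‖ * s * t :=
    (abs_real_inner_le_norm _ _).trans (mul_le_mul
      ((a.le_opNorm _).trans (mul_le_mul_of_nonneg_left df (norm_nonneg _))) dg (norm_nonneg _)
      (by positivity))
  have h2 : |inner ℝ (S.actionLinear V b g) (S.gradLinear V f)| ≤ √(δ + γ) * t * s :=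
    (abs_real_inner_le_norm _ _).trans (mul_le_mul hbf df (norm_nonneg _) (by positivity))
  have h3 : |inner ℝ (S.actionLinear V b' f) (S.gradLinear V g)| ≤ √(δ' + γ') * s * t :=
    (abs_real_inner_le_norm _ _).trans (mul_le_mul hbf' dg (norm_nonneg _) (by positivity))
  have h4 : |inner ℝ (S.mulCore μ hc f) (S.coreToLp μ g)| ≤ (eLpNorm c ⊤ μ).toReal * s * t :=
    (abs_real_inner_le_norm _ _).trans (mul_le_mul ((S.norm_mulCore_le μ hc f).trans
      (mul_le_mul_of_nonneg_left jf hC)) jg (norm_nonneg _) (by positivity))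
  rw [abs_le] at *
  constructor <;> linarith [h1.1, h1.2, h2.1, h2.2, h3.1, h3.2, h4.1, h4.2]

/-- Ellipticity bounds the leading term below, Cauchy–Schwarz bounds the drifts by $\|f\cdot
b\|\|\partial f\|$ and $\|f\cdot\hat b\|\|\partial f\|$, and `coercivity_aux` absorbs them. The
coefficient of $\|f\|^2$ is the $c_0$ of the theorem. -/
theorem le_formQ {c : X → ℝ} (hc : MemLp c ⊤ μ) {lam Lam δ δ' γ γ' lam₀ : ℝ}
    (ha : S.IsUniformlyElliptic V a lam Lam)
    (hb : S.Hardy V μ b δ γ) (hb' : S.Hardy V μ b' δ' γ')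
    (hlam : lam₀ = (lam - √δ - √δ') / 2) (hlam₀ : 0 < lam₀) (f : S.core) :
    lam₀ * ‖S.gradLinear V f‖ ^ 2 +
      (essInf (fun x => -c x) μ - (γ + γ') / (2 * lam₀)) * ‖S.coreToLp μ f‖ ^ 2 ≤
        S.formQ V μ a b b' c f f := by
  refine coercivity_aux (norm_nonneg _) (norm_nonneg _) hb.1.le hb'.1.le hb.2.1 hb'.2.1
    (hb.norm_sq_le S μ f) (hb'.norm_sq_le S μ f) hlam hlam₀ ?_
  rw [S.formQ_eq V μ a b b' hc]
  have h1 := (ha.2.2.2 (S.gradLinear V f)).1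
  have h2 := real_inner_le_norm (S.actionLinear V b f) (S.gradLinear V f)
  have h3 := real_inner_le_norm (S.actionLinear V b' f) (S.gradLinear V f)
  have h4 := S.inner_mulCore_le μ hc f
  linarith

/-! ### Identification of the closed form and its generator on the graph closure. -/

section ClosureForm

variable {q : S.core → S.core → ℝ}
  {B : GraphClosure (S.coreToLp μ) (S.gradLinear V) →L[ℝ]
    GraphClosure (S.coreToLp μ) (S.gradLinear V) →L[ℝ] ℝ}
  (hB : ∀ f g, B (toGraphClosure _ _ f) (toGraphClosure _ _ g) = q f g)

theorem IsApprox.exists_tendsto {f : ℕ → S.core} {u : Lp ℝ 2 μ} (h : S.IsApprox μ f u) :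
    ∃ w, graphFst (S.coreToLp μ) (S.gradLinear V) w = u ∧
      Tendsto (fun n => toGraphClosure (S.coreToLp μ) (S.gradLinear V) (f n)) atTop (𝓝 w) := by
  obtain ⟨h1, h2⟩ := (S.isApprox_iff V μ).1 h
  obtain ⟨w, hw⟩ := cauchySeq_tendsto_of_complete
    ((cauchySeq_toGraphClosure_iff _ _).2 ⟨h1.cauchySeq, h2⟩)
  exact ⟨w, tendsto_nhds_unique (((graphFst _ _).continuous.tendsto w).comp hw) h1, hw⟩

theorem exists_isApprox (w : GraphClosure (S.coreToLp μ) (S.gradLinear V)) :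
    ∃ f, S.IsApprox μ f (graphFst _ _ w) := by
  obtain ⟨f, hf⟩ := exists_tendsto_toGraphClosure _ _ w
  exact ⟨f, (S.isApprox_iff V μ).2 ⟨((graphFst _ _).continuous.tendsto w).comp hf,
    ((cauchySeq_toGraphClosure_iff _ _).1 hf.cauchySeq).2⟩⟩

theorem mem_domain_iff {u : Lp ℝ 2 μ} :
    u ∈ S.domain μ ↔ ∃ w, graphFst (S.coreToLp μ) (S.gradLinear V) w = u := by
  constructor
  · rintro ⟨f, hf⟩
    obtain ⟨w, hw, -⟩ := hf.exists_tendsto S μ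
    exact ⟨w, hw⟩
  · rintro ⟨w, rfl⟩
    exact S.exists_isApprox μ w

variable [Nonempty X] [μ.IsOpenPosMeasure]

theorem injective_graphFst_coreToLp :
    Function.Injective (graphFst (S.coreToLp μ) (S.gradLinear V)) :=
  injective_graphFst _ _ (S.tendsto_grad_zero V μ)

include hB

/-- All approximating sequences of $u$ converge in the graph closure, and injectivity of the
projection forces the same limit on each. Continuity of $B$ does the rest. -/
theorem isClosureValue (w z : GraphClosure (S.coreToLp μ) (S.gradLinear V)) :
    S.IsClosureValue μ q (graphFst _ _ w) (graphFst _ _ z) (B w z) := by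
  intro f g hf hg
  obtain ⟨w', hw', hfw⟩ := hf.exists_tendsto S μ (V := V)
  obtain ⟨z', hz', hgz⟩ := hg.exists_tendsto S μ (V := V)
  rw [← S.injective_graphFst_coreToLp μ hw', ← S.injective_graphFst_coreToLp μ hz']
  have hc : Continuous fun p : GraphClosure (S.coreToLp μ) (S.gradLinear V) ×
      GraphClosure (S.coreToLp μ) (S.gradLinear V) => B p.1 p.2 := by fun_prop
  refine ((hc.tendsto (w', z')).comp (hfw.prodMk_nhds hgz)).congr fun n => ?_
  exact hB _ _

/-- The chosen value is unique because approximating sequences exist, so the condition on it is not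
vacuous; the default value $0$ plays no role on $\mathcal D(\mathcal E)$. -/
theorem closureForm_graphFst (w z : GraphClosure (S.coreToLp μ) (S.gradLinear V)) :
    S.closureForm μ q (graphFst _ _ w) (graphFst _ _ z) = B w z := by
  have h : ∃ r, S.IsClosureValue μ q (graphFst _ _ w) (graphFst _ _ z) r :=
    ⟨_, S.isClosureValue μ hB w z⟩
  rw [closureForm, dif_pos h]
  obtain ⟨f, hf⟩ := S.exists_isApprox μ w
  obtain ⟨g, hg⟩ := S.exists_isApprox μ z
  exact tendsto_nhds_unique (h.choose_spec f g hf hg) (S.isClosureValue μ hB w z f g hf hg)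

theorem generator_eq_formGenerator :
    S.generator μ q = formGenerator B (graphFst (S.coreToLp μ) (S.gradLinear V)) := by
  ext p
  constructor
  · rintro ⟨h1, h2⟩
    obtain ⟨w, hw⟩ := (S.mem_domain_iff μ (V := V)).1 h1
    refine ⟨w, hw, fun v => ?_⟩
    rw [← S.closureForm_graphFst μ hB, hw]
    exact h2 _ ((S.mem_domain_iff μ).2 ⟨v, rfl⟩)
  · rintro ⟨w, hw, h⟩
    refine ⟨(S.mem_domain_iff μ).2 ⟨w, hw⟩, fun v hv => ?_⟩
    obtain ⟨z, rfl⟩ := (S.mem_domain_iff μ (V := V)).1 hv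
    rw [← hw, S.closureForm_graphFst μ hB, h]

end ClosureForm

end RegularResistanceForm

end

/-! ### The main theorem. -/

theorem corollary3p4 :
    ∃ C : ℝ → ℝ, (∀ K, 0 < K → 0 < C K) ∧
    ∀ (X : Type u) [MetricSpace X] [ProperSpace X] [Nonempty X] [MeasurableSpace X] [BorelSpace X]
      (S : RegularResistanceForm X) (V : ExhaustingSequence X) (μ : Measure X)
      (a : S.VecField V →L[ℝ] S.VecField V) (b b' : S.VecField V) (c : X → ℝ)
      (lam Lam δ δ' γ γ' lam₀ c₀ : ℝ),
      (∀ (x : X) (r : ℝ), 0 < r → 0 < μ (Metric.ball x r) ∧ μ (Metric.ball x r) < ⊤) →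
      S.IsUniformlyElliptic V a lam Lam →
      S.Hardy V μ b δ γ → S.Hardy V μ b' δ' γ' →
      MemLp c ⊤ μ →
      lam₀ = (lam - √δ - √δ') / 2 → 0 < lam₀ →
      c₀ = essInf (fun x => - c x) μ - (γ + γ') / (2 * lam₀) → 0 < c₀ →
      -- the form `Q` extends to `D(E)` by continuity
      (∀ u ∈ S.domain μ, ∀ v ∈ S.domain μ, S.IsClosureValue μ (S.formQ V μ a b b' c) u v
        (S.closureForm μ (S.formQ V μ a b b' c) u v)) ∧
      -- its generator satisfies a sector condition
      (∃ K, 0 < K ∧ SectorCondition (S.generator μ (S.formQ V μ a b b' c)) (c₀ / 2) K) ∧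
      -- and generates a unique strongly continuous contraction semigroup
      (∃! T : NNReal → Lp ℝ 2 μ →L[ℝ] Lp ℝ 2 μ, IsContractionSemigroup T ∧
        semigroupGenerator T = S.generator μ (S.formQ V μ a b b' c)) ∧
      ∀ T : NNReal → Lp ℝ 2 μ →L[ℝ] Lp ℝ 2 μ, IsContractionSemigroup T →
        semigroupGenerator T = S.generator μ (S.formQ V μ a b b' c) →
        ∀ u₀ : Lp ℝ 2 μ,
          IsCauchySolution (S.generator μ (S.formQ V μ a b b' c)) u₀
            (fun t => T t.toNNReal u₀) ∧
          (∀ u : ℝ → Lp ℝ 2 μ,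
            IsCauchySolution (S.generator μ (S.formQ V μ a b b' c)) u₀ u →
              ∀ t : ℝ, 0 ≤ t → u t = T t.toNNReal u₀) ∧
          (∀ t : ℝ, 0 < t →
            ∃ h, (T t.toNNReal u₀, h) ∈ S.generator μ (S.formQ V μ a b b' c)) ∧
          ∀ K : ℝ, 0 < K →
            SectorCondition (S.generator μ (S.formQ V μ a b b' c)) (c₀ / 2) K →
            ∀ t : ℝ, 0 < t →
              S.closureForm μ (S.formQ V μ a b b' c) (T t.toNNReal u₀) (T t.toNNReal u₀)
                + ‖T t.toNNReal u₀‖ ^ 2 ≤ (C K / t + 1) * ‖u₀‖ ^ 2 := by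
  refine ⟨fun K => K / 2, fun K hK => half_pos hK, ?_⟩
  intro X _ _ _ _ _ S V μ a b b' c lam Lam δ δ' γ γ' lam₀ c₀ hμ ha hb hb' hc hlam hlam₀ hc₀ hc₀p
  have : IsLocallyFiniteMeasure μ :=
    ⟨fun x => ⟨_, Metric.ball_mem_nhds x one_pos, (hμ x 1 one_pos).2⟩⟩
  have : μ.IsOpenPosMeasure := ⟨fun U hU ⟨x, hx⟩ h0 => by
    obtain ⟨r, hr, hsub⟩ := Metric.isOpen_iff.1 hU x hx
    exact ((hμ x r hr).1.trans_le (measure_mono hsub)).ne' h0⟩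
  set j := S.coreToLp μ
  set d := S.gradLinear V
  obtain ⟨B, hB⟩ := exists_bilinear_extension (denseRange_toGraphClosure j d)
    (S.formBilin V μ a b b' hc) (by positivity) (S.abs_formQ_le μ hc hb hb')
  have hBq : ∀ f g, B (toGraphClosure j d f) (toGraphClosure j d g) =
    S.formQ V μ a b b' c f g := hB
  have hm : 0 < min lam₀ (c₀ / 2) := lt_min hlam₀ (half_pos hc₀p)
  -- The splitting $c_0=c_0/2+c_0/2$ leaves coercivity on $W$ after any shift $\varepsilon\le
  -- c_0/2$. The bound passes from $\mathcal F\cap C_c(X)$ to $W$ by density.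
  have hcoer : ∀ w, min lam₀ (c₀ / 2) * ‖w‖ ^ 2 + c₀ / 2 * ‖graphFst j d w‖ ^ 2 ≤ B w w := by
    intro w
    refine (denseRange_toGraphClosure j d).induction_on w
      (isClosed_le (by fun_prop) (by fun_prop)) fun f => ?_
    rw [hBq, norm_sq_graphClosure, graphFst_toGraphClosure, graphSnd_toGraphClosure]
    have h1 := S.le_formQ μ hc ha hb hb' hlam hlam₀ f
    rw [← hc₀] at h1
    have h2 := mul_le_mul_of_nonneg_right (min_le_left lam₀ (c₀ / 2)) (sq_nonneg ‖d f‖)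
    have h3 := mul_le_mul_of_nonneg_right (min_le_right lam₀ (c₀ / 2)) (sq_nonneg ‖j f‖)
    linarith
  have hcoer' : ∀ w, min lam₀ (c₀ / 2) * ‖w‖ ^ 2 ≤ B w w := fun w =>
    (le_add_of_nonneg_right (by positivity)).trans (hcoer w)
  have hdense : DenseRange (graphFst j d) :=
    (S.denseRange_coreToLp μ V).mono (by
      rintro _ ⟨f, rfl⟩
      exact ⟨toGraphClosure j d f, rfl⟩)
  have hL : MDissipative (formGenerator B (graphFst j d)) :=
    mDissipative_formGenerator (S.injective_graphFst_coreToLp μ) hdense hm hcoer'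
  have hsec : ∃ K, 0 < K ∧
      SectorCondition (formGenerator B (graphFst j d) : Set (Lp ℝ 2 μ × Lp ℝ 2 μ)) (c₀ / 2) K :=
    formGenerator_sectorCondition hm (norm_graphFst_le j d) hcoer
  have hcv := S.isClosureValue μ hBq
  have hcf := S.closureForm_graphFst μ hBq
  rw [S.generator_eq_formGenerator μ hBq]
  have hsec0 : ∀ K, SectorCondition
      (formGenerator B (graphFst j d) : Set (Lp ℝ 2 μ × Lp ℝ 2 μ)) (c₀ / 2) K →
      ∀ p ∈ formGenerator B (graphFst j d), ∀ q ∈ formGenerator B (graphFst j d),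
        |inner ℝ (-p.2) q.1| ≤ K * √(inner ℝ (-p.2) p.1) * √(inner ℝ (-q.2) q.1) := by
    intro K hK p hp q hq
    simpa using hK 0 le_rfl (by positivity) p hp q hq
  have hsmooth : ∀ T : NNReal → Lp ℝ 2 μ →L[ℝ] Lp ℝ 2 μ, IsContractionSemigroup T →
      semigroupGenerator T = formGenerator B (graphFst j d) → ∀ x (t : ℝ), 0 < t →
        ∃ h, (T t.toNNReal x, h) ∈ formGenerator B (graphFst j d) := by
    intro T hT hgen x t ht
    obtain ⟨K, hK, hs⟩ := hsec
    obtain ⟨h, hh, -⟩ := hT.exists_generator_norm_le hL hgen hK (hsec0 K hs) x ht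
    exact ⟨h, hh⟩
  refine ⟨?_, hsec, ?_, ?_⟩
  · intro u hu v hv
    obtain ⟨w, rfl⟩ := (S.mem_domain_iff μ (V := V)).1 hu
    obtain ⟨z, rfl⟩ := (S.mem_domain_iff μ (V := V)).1 hv
    rw [hcf]
    exact hcv w z
  · obtain ⟨T, hT, hgen⟩ := hL.exists_semigroupGenerator_eq
    refine ⟨T, ⟨hT, hgen⟩, fun T' ⟨hT', hgen'⟩ => ?_⟩
    ext1 t
    ext1 x
    -- Two semigroups with this generator have orbits solving the same Cauchy problem, so they
    -- coincide.
    have := hL.isCauchySolution_unique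
      (hT'.isCauchySolution hgen' (hsmooth T' hT' hgen') x)
      (hT.isCauchySolution hgen (hsmooth T hT hgen) x) t.coe_nonneg
    simpa using this
  · intro T hT hgen u₀
    have hsol := hT.isCauchySolution hgen (hsmooth T hT hgen) u₀
    refine ⟨hsol, fun u hu t ht => hL.isCauchySolution_unique hu hsol ht,
      fun t ht => hsmooth T hT hgen u₀ t ht, fun K hK hs t ht => ?_⟩
    obtain ⟨h, hmem, hle⟩ := hT.exists_generator_norm_le hL hgen hK (hsec0 K hs) u₀ ht
    obtain ⟨w, hw, hwv⟩ := hmem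
    have hnorm := hT.norm_apply_le t.toNNReal u₀
    simp only at hw hwv
    rw [← hw] at hnorm ⊢
    -- Now $\mathcal Q(u(t))=-\langle h,u(t)\rangle$ with $h=\mathcal Lu(t)$. Cauchy–Schwarz with
    -- the smoothing bound on $h$ and contractivity finish the estimate.
    rw [hcf, hwv]
    have h1 := neg_le_of_abs_le (abs_real_inner_le_norm h (graphFst j d w))
    have h2 := mul_le_mul hle hnorm (norm_nonneg _) (by positivity)
    have h3 := pow_le_pow_left₀ (norm_nonneg _) hnorm 2
    have h4 : K / (2 * t) * ‖u₀‖ * ‖u₀‖ = K / 2 / t * ‖u₀‖ ^ 2 := by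
      field_simp
    nlinarith
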